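/- Let $k\ge 3$. There is $L=L(k)$ such that the following holds for every $\ell\ge L$. Let $G$ be a finite simple $\ell$-partite graph with nonempty parts $V_1,\dots,V_\ell$ such that for all $i\neq j$ $$d(V_i,V_j):=\frac{\|G[V_i\cup V_j]\|}{|V_i|\,|V_j|}\ \ge\ \frac{k-2}{k-1},$$ where $\|\cdot\|$ denotes the number of edges. Then $G$ contains a complete graph $K^k$, or $G$ is isomorphic to a graph in the class $\mathcal G^k_\ell$ defined as follows. Let $\pi_1,\dots,\pi_{(k-1)!}$ be any enumeration of all permutations of $\{1,\dots,k-1\}$. For $\ell\ge (k-1)!$, the class $\bar{\mathcal G}^k_\ell$ consists of the graphs with vertex set $\{(i,s,t): 1\le i\le \ell,\ 1\le s\le k-1,\ 1\le t\le n_i^s\}$ in which $(i,s,t)$ and $(i',s',t')$ are adjacent if and only if $i\ne i'$ and $s\neq s'$, where the $n_i^s$ are nonnegative integers such that - $n_i^{\pi_i(1)}\ge n_i^{\pi_i(2)}\ge\dots\ge n_i^{\pi_i(k-1)}$ for $1\le i\le (k-1)!$, - $n_i^1=n_i^2=\dots=n_i^{k-1}$ for $(k-1)!<i\le \ell$, -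 $\sum_{s} n_i^s>0$ for $1\le i\le \ell$. The class $\mathcal G^k_\ell$ consists of all graphs obtained from a graph in $\bar{\mathcal G}^k_\ell$ by deleting some (possibly no) edges of the form $(i,s,t)(i',s',t')$ with $s\ne s'$ and $1\le i<i'\le (k-1)!$. -/

import Mathlib

open scoped Nat

namespace PartiteTuran

/-- `G` is an `ℓ`-partite graph with (nonempty) parts `P 0, …, P (ℓ - 1)`: the parts are
pairwise disjoint, they cover the vertex set, and no edge of `G` lies inside a part. -/
structure IsPartite {V : Type*} {ℓ : ℕ} (G : SimpleGraph V) (P : Fin ℓ → Finset V) : Prop where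
  nonempty : ∀ i, (P i).Nonempty
  disjoint : ∀ i j, i ≠ j → Disjoint (P i) (P j)
  cover : ∀ v, ∃ i, v ∈ P i
  independent : ∀ i, ∀ u ∈ P i, ∀ v ∈ P i, ¬ G.Adj u v

/-- The vertex set of triples `(i, s, t)` with `i` one of `ℓ` parts, `s` one of `m` classes,
and `t` one of `n i s` vertices. -/
abbrev BlowupVertex {ℓ m : ℕ} (n : Fin ℓ → Fin m → ℕ) : Type :=
  (i : Fin ℓ) × (s : Fin m) × Fin (n i s)

/-- The graph on the triples `(i, s, t)` in which `(i, s, t)` and `(i', s', t')` are adjacent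
if and only if `i ≠ i'` and `s ≠ s'`. -/
def blowup {ℓ m : ℕ} (n : Fin ℓ → Fin m → ℕ) : SimpleGraph (BlowupVertex n) where
  Adj x y := x.1 ≠ y.1 ∧ x.2.1 ≠ y.2.1
  symm := ⟨fun _ _ h => ⟨h.1.symm, h.2.symm⟩⟩
  loopless := ⟨fun _ h => h.1 rfl⟩

/-- The conditions on the class sizes `n i s`, where `π` enumerates all `m!` permutations of
the `m` classes: the sizes in the `i`-th part are weakly decreasing in the order given by
the `i`-th permutation, for each of the first `m!` parts; in every later part all sizes are
equal; and no part is empty. -/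
structure AdmissibleSizes {ℓ m : ℕ} (π : Fin (m !) ≃ Equiv.Perm (Fin m))
    (n : Fin ℓ → Fin m → ℕ) : Prop where
  le : m ! ≤ ℓ
  sorted : ∀ (i : Fin ℓ) (hi : (i : ℕ) < m !) (r r' : Fin m), r ≤ r' →
    n i (π ⟨i, hi⟩ r') ≤ n i (π ⟨i, hi⟩ r)
  balanced : ∀ i : Fin ℓ, m ! ≤ (i : ℕ) → ∀ s s' : Fin m, n i s = n i s'
  pos : ∀ i, 0 < ∑ s, n i s

/-- The extremal class (for cliques on `m + 1` vertices): the class sizes are admissible, and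
`H` is obtained from the graph `blowup n` by deleting edges, all of which have both ends
in the first `m!` parts. -/
structure IsExtremal {ℓ m : ℕ} (π : Fin (m !) ≃ Equiv.Perm (Fin m))
    (n : Fin ℓ → Fin m → ℕ) (H : SimpleGraph (BlowupVertex n)) : Prop where
  sizes : AdmissibleSizes π n
  le : H ≤ blowup n
  deleted : ∀ x y, (blowup n).Adj x y → ¬ H.Adj x y →
    (x.1 : ℕ) < m ! ∧ (y.1 : ℕ) < m !

end PartiteTuran

/-!
Write `m = k - 1`, and give every vertex the reciprocal of the size of its part as its weight, so
that all parts have weight one. The heart of the proof is that a `K_{m+1}`-free graph satisfying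
the density condition is properly `m`-colourable once there are many parts
(`exists_proper_coloring_of_isDense`).

* Peeling off non-neighbourhoods of vertices of maximum degree gives an `m`-colouring in which
  the missing pairs of distinct colours weigh at least twice as much as the monochromatic edges
  (`exists_coloring_two_mul_inside_le`; this also yields a weighted Turán theorem). With the
  density condition, both weights are linear in the number of parts, while the number of pairs
  of parts is quadratic. Hence there are many parts between any two of which both are tiny, and
  many of these are nearly balanced, by the pigeonhole principle
  (`exists_isNearTuran`).
* Among such parts, recolour each vertex by a colour it hardly sees, and keep parts whose colour
  classes are ordered alike by size. Chebyshev's sum inequality says that two such parts have at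
  least a proportion `1 / m` of monochromatic pairs, so the density condition forces the
  monochromatic edges to weigh at least as much as the missing pairs. On the other hand, an end of
  a monochromatic edge misses far more than it can gain. So neither kind of pair occurs, and
  equality in Chebyshev's inequality makes all but one of the parts exactly balanced
  (`IsNearTuran.exists_isExactTuran`).
* Against balanced parts that form a complete multipartite graph, the density condition leaves
  every other part no choice: each vertex is joined to everything except one colour. Two adjacent
  vertices with the same missing colour would complete a `K_{m+1}`
  (`IsExactTuran.exists_proper_coloring`).

Given a proper `m`-colouring, Chebyshev's inequality shows that no two unbalanced parts have colour
classes ordered alike, and that pairs at a balanced part are never missing. Placing the unbalanced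
parts at the indices of the permutations that sort them identifies the graph with a member of the
extremal class (`exists_isExtremal`).
-/

namespace PartiteTuran

/-! ### Weights of vertex sets and pairs, and weighted Turán theory -/

section Weighted

open scoped Classical

variable {V : Type*}

/-- The total weight of a finite set of vertices. -/
noncomputable def mass (w : V → ℚ) (A : Finset V) : ℚ := ∑ v ∈ A, w v

/-- The total weight `w u * w v` of the ordered pairs `(u, v)` with `u ∈ A`, `v ∈ B` that
are related by `R`. -/
noncomputable def pairMass (w : V → ℚ) (R : V → V → Prop) (A B : Finset V) : ℚ :=
  ∑ u ∈ A, ∑ v ∈ B, if R u v then w u * w v else 0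

variable {w : V → ℚ} {R R' : V → V → Prop} {A A' B B' : Finset V}

lemma mass_nonneg (hw : ∀ v, 0 ≤ w v) : 0 ≤ mass w A :=
  Finset.sum_nonneg fun v _ => hw v

lemma mass_mono (hw : ∀ v, 0 ≤ w v) (h : A ⊆ B) : mass w A ≤ mass w B :=
  Finset.sum_le_sum_of_subset_of_nonneg h fun v _ _ => hw v

lemma mass_union_le (hw : ∀ v, 0 ≤ w v) : mass w (A ∪ B) ≤ mass w A + mass w B := by
  have := Finset.sum_union_inter (s₁ := A) (s₂ := B) (f := w)
  have h2 := mass_nonneg (A := A ∩ B) hw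
  unfold mass at *
  linarith

lemma pairMass_eq_sum_mass [DecidableRel R] :
    pairMass w R A B = ∑ u ∈ A, w u * mass w (B.filter (R u)) := by
  unfold pairMass mass
  refine Finset.sum_congr rfl fun u _ => ?_
  rw [Finset.mul_sum, Finset.sum_filter]
  exact Finset.sum_congr rfl fun v _ => by congr

lemma pairMass_nonneg (hw : ∀ v, 0 ≤ w v) : 0 ≤ pairMass w R A B := by
  refine Finset.sum_nonneg fun u _ => Finset.sum_nonneg fun v _ => ?_
  split_ifs
  · exact mul_nonneg (hw u) (hw v)
  · exact le_rfl

lemma pairMass_mono (hw : ∀ v, 0 ≤ w v) (hA : A ⊆ A') (hB : B ⊆ B')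
    (hR : ∀ u ∈ A, ∀ v ∈ B, R u v → R' u v) : pairMass w R A B ≤ pairMass w R' A' B' := by
  have hnn : ∀ u v, 0 ≤ if R' u v then w u * w v else 0 := by
    intro u v
    split_ifs
    · exact mul_nonneg (hw u) (hw v)
    · exact le_rfl
  calc pairMass w R A B ≤ ∑ u ∈ A, ∑ v ∈ B, if R' u v then w u * w v else 0 := by
        refine Finset.sum_le_sum fun u hu => Finset.sum_le_sum fun v hv => ?_
        by_cases h : R u v
        · simp [h, hR u hu v hv h]
        · simpa [h] using hnn u v
    _ ≤ ∑ u ∈ A, ∑ v ∈ B', if R' u v then w u * w v else 0 :=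
        Finset.sum_le_sum fun u _ =>
          Finset.sum_le_sum_of_subset_of_nonneg hB fun v _ _ => hnn u v
    _ ≤ pairMass w R' A' B' :=
        Finset.sum_le_sum_of_subset_of_nonneg hA fun u _ _ =>
          Finset.sum_nonneg fun v _ => hnn u v

lemma pairMass_congr (hR : ∀ u ∈ A, ∀ v ∈ B, (R u v ↔ R' u v)) :
    pairMass w R A B = pairMass w R' A B := by
  refine Finset.sum_congr rfl fun u hu => Finset.sum_congr rfl fun v hv => ?_
  simp only [hR u hu v hv]

lemma pairMass_comm (hR : ∀ u v, R u v → R v u) :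
    pairMass w R A B = pairMass w R B A := by
  unfold pairMass
  rw [Finset.sum_comm]
  refine Finset.sum_congr rfl fun u _ => Finset.sum_congr rfl fun v _ => ?_
  have : R u v ↔ R v u := ⟨hR _ _, hR _ _⟩
  simp only [this, mul_comm]

lemma pairMass_union_left (h : Disjoint A A') :
    pairMass w R (A ∪ A') B = pairMass w R A B + pairMass w R A' B :=
  Finset.sum_union h

lemma pairMass_union_right (h : Disjoint B B') :
    pairMass w R A (B ∪ B') = pairMass w R A B + pairMass w R A B' := by
  unfold pairMass
  rw [← Finset.sum_add_distrib]
  exact Finset.sum_congr rfl fun u _ => Finset.sum_union h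

lemma pairMass_biUnion {κ : Type*} {T : Finset κ} {P : κ → Finset V}
    (h : (T : Set κ).PairwiseDisjoint P) :
    pairMass w R (T.biUnion P) (T.biUnion P) = ∑ s ∈ T, ∑ t ∈ T, pairMass w R (P s) (P t) := by
  have : pairMass w R (T.biUnion P) (T.biUnion P) =
      ∑ s ∈ T, pairMass w R (P s) (T.biUnion P) := Finset.sum_biUnion h
  rw [this]
  refine Finset.sum_congr rfl fun s _ => ?_
  unfold pairMass
  exact (Finset.sum_congr rfl fun u _ => Finset.sum_biUnion h).trans Finset.sum_comm

lemma pairMass_add_not :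
    pairMass w R A B + pairMass w (fun u v => ¬ R u v) A B = mass w A * mass w B := by
  unfold pairMass mass
  rw [Finset.sum_mul_sum, ← Finset.sum_add_distrib]
  refine Finset.sum_congr rfl fun u _ => ?_
  rw [← Finset.sum_add_distrib]
  refine Finset.sum_congr rfl fun v _ => ?_
  by_cases h : R u v <;> simp [h]

lemma pairMass_eq_zero (h : ∀ u ∈ A, ∀ v ∈ B, ¬ R u v) : pairMass w R A B = 0 :=
  Finset.sum_eq_zero fun u hu => Finset.sum_eq_zero fun v hv => by simp [h u hu v hv]

lemma not_rel_of_pairMass_eq_zero (hw : ∀ v, 0 < w v) (h : pairMass w R A B = 0) {u v : V}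
    (hu : u ∈ A) (hv : v ∈ B) : ¬ R u v := by
  intro hR
  have h1 : pairMass w R {u} {v} ≤ pairMass w R A B :=
    pairMass_mono (fun v => (hw v).le) (by simpa using hu) (by simpa using hv) (by simp)
  have h2 : pairMass w R {u} {v} = w u * w v := by simp [pairMass, hR]
  have := mul_pos (hw u) (hw v)
  linarith

/-- The pairs of equal colour, in terms of the masses of the colour classes. -/
lemma pairMass_same_eq {κ : Type*} [DecidableEq κ] (c : V → κ) (T : Finset κ)
    (hT : ∀ u ∈ A, c u ∈ T) :
    pairMass w (fun u v => c u = c v) A B =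
      ∑ s ∈ T, mass w (A.filter (c · = s)) * mass w (B.filter (c · = s)) := by
  rw [pairMass_eq_sum_mass, ← Finset.sum_fiberwise_of_maps_to hT]
  refine Finset.sum_congr rfl fun s _ => ?_
  unfold mass
  rw [Finset.sum_mul]
  refine Finset.sum_congr rfl fun u hu => ?_
  have : c u = s := (Finset.mem_filter.1 hu).2
  rw [this]
  refine congrArg _ (Finset.sum_congr ?_ fun _ _ => rfl)
  ext v
  simp [eq_comm]

lemma sum_mass_filter {κ : Type*} [DecidableEq κ] (c : V → κ) (T : Finset κ) (hT : ∀ u ∈ A, c u ∈ T) :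
    ∑ s ∈ T, mass w (A.filter (c · = s)) = mass w A :=
  Finset.sum_fiberwise_of_maps_to hT w

variable (G : SimpleGraph V)

/-- Edges are all pairs of distinct colour, with the missing ones taken away and the
monochromatic ones added. -/
lemma pairMass_adj_eq {κ : Type*} (c : V → κ) :
    pairMass w G.Adj A B = mass w A * mass w B - pairMass w (fun u v => c u = c v) A B
      + pairMass w (fun u v => G.Adj u v ∧ c u = c v) A B
      - pairMass w (fun u v => ¬ G.Adj u v ∧ c u ≠ c v) A B := by
  unfold pairMass mass
  rw [Finset.sum_mul_sum, ← Finset.sum_sub_distrib, ← Finset.sum_add_distrib,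
    ← Finset.sum_sub_distrib]
  refine Finset.sum_congr rfl fun u _ => ?_
  rw [← Finset.sum_sub_distrib, ← Finset.sum_add_distrib, ← Finset.sum_sub_distrib]
  refine Finset.sum_congr rfl fun v _ => ?_
  by_cases h : G.Adj u v <;> by_cases h' : c u = c v <;> simp [h, h']

variable {G}

/-- A graph without `K_{m+1}` has an `m`-colouring in which the weight of the monochromatic
edges is at most half the weight of the missing pairs of distinct colour. The colour classes
are peeled off one by one: the non-neighbours of a vertex of maximum degree form a class. -/
lemma exists_coloring_two_mul_inside_le (hw : ∀ v, 0 ≤ w v) :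
    ∀ (m : ℕ) (S : Finset V), G.CliqueFreeOn S (m + 1) →
      ∃ c : V → ℕ, (∀ v ∈ S, c v < m) ∧
        2 * pairMass w (fun u v => G.Adj u v ∧ c u = c v) S S ≤
          pairMass w (fun u v => ¬ G.Adj u v ∧ c u ≠ c v) S S := by
  intro m
  induction m with
  | zero =>
    intro S hS
    have hS0 : S = ∅ := by
      by_contra h
      obtain ⟨x, hx⟩ := Finset.nonempty_iff_ne_empty.2 h
      exact hS (t := {x}) (by simpa using hx) (by simp [SimpleGraph.isNClique_iff])
    subst hS0
    exact ⟨fun _ => 0, by simp, by simp [pairMass]⟩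
  | succ m ih =>
    intro S hS
    rcases S.eq_empty_or_nonempty with rfl | hne
    · exact ⟨fun _ => 0, by simp, by simp [pairMass]⟩
    obtain ⟨x, hxS, hmax⟩ := S.exists_max_image (fun u => mass w (S.filter (G.Adj u))) hne
    set S' := S.filter (G.Adj x) with hS'
    set A := S.filter (fun v => ¬ G.Adj x v) with hA
    have hdisj : Disjoint A S' := (Finset.disjoint_filter_filter_not S S (G.Adj x)).symm
    have hunion : A ∪ S' = S := by
      rw [Finset.union_comm]; exact Finset.filter_union_filter_not_eq (G.Adj x) S
    obtain ⟨c', hc', hle⟩ := ih S' (by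
      have := SimpleGraph.CliqueFreeOn.of_succ G hS (a := x) (by simpa using hxS)
      refine SimpleGraph.CliqueFreeOn.subset G ?_ this
      intro v hv
      simpa [hS', Finset.mem_filter] using hv)
    refine ⟨fun v => if G.Adj x v then c' v else m, ?_, ?_⟩
    · intro v hv
      by_cases h : G.Adj x v
      · have := hc' v (by simp [hS', hv, h])
        simp only [h, if_true]; omega
      · simp [h]
    set c : V → ℕ := fun v => if G.Adj x v then c' v else m with hc
    have hcS : ∀ v ∈ S', c v = c' v := by
      intro v hv
      simp [hc, (Finset.mem_filter.1 hv).2]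
    have hcA : ∀ v ∈ A, c v = m := by
      intro v hv
      simp [hc, (Finset.mem_filter.1 hv).2]
    have hne' : ∀ u ∈ A, ∀ v ∈ S', c u ≠ c v := by
      intro u hu v hv
      rw [hcA u hu, hcS v hv]
      exact (hc' v hv).ne'
    have e : ∀ R : V → V → Prop, pairMass w R S S =
        pairMass w R A A + pairMass w R A S' + pairMass w R S' A + pairMass w R S' S' := by
      intro R
      rw [← hunion, pairMass_union_left hdisj, pairMass_union_right hdisj,
        pairMass_union_right hdisj]
      ring
    rw [e, e]
    have i1 : pairMass w (fun u v => G.Adj u v ∧ c u = c v) A A = pairMass w G.Adj A A :=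
      pairMass_congr fun u hu v hv => by simp [hcA u hu, hcA v hv]
    have i2 : pairMass w (fun u v => G.Adj u v ∧ c u = c v) A S' = 0 :=
      pairMass_eq_zero fun u hu v hv h => hne' u hu v hv h.2
    have i3 : pairMass w (fun u v => G.Adj u v ∧ c u = c v) S' A = 0 :=
      pairMass_eq_zero fun u hu v hv h => hne' v hv u hu h.2.symm
    have i4 : pairMass w (fun u v => G.Adj u v ∧ c u = c v) S' S' =
        pairMass w (fun u v => G.Adj u v ∧ c' u = c' v) S' S' :=
      pairMass_congr fun u hu v hv => by simp [hcS u hu, hcS v hv]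
    have j1 : 0 ≤ pairMass w (fun u v => ¬ G.Adj u v ∧ c u ≠ c v) A A := pairMass_nonneg hw
    have j2 : pairMass w (fun u v => ¬ G.Adj u v ∧ c u ≠ c v) A S' =
        pairMass w (fun u v => ¬ G.Adj u v) A S' :=
      pairMass_congr fun u hu v hv => by simp [hne' u hu v hv]
    have j3 : pairMass w (fun u v => ¬ G.Adj u v ∧ c u ≠ c v) S' A =
        pairMass w (fun u v => ¬ G.Adj u v) A S' := by
      rw [← j2]
      exact pairMass_comm fun u v h => ⟨fun h' => h.1 h'.symm, h.2.symm⟩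
    have j4 : pairMass w (fun u v => ¬ G.Adj u v ∧ c u ≠ c v) S' S' =
        pairMass w (fun u v => ¬ G.Adj u v ∧ c' u ≠ c' v) S' S' :=
      pairMass_congr fun u hu v hv => by simp [hcS u hu, hcS v hv]
    rw [i1, i2, i3, i4, j2, j3, j4]
    have k1 := pairMass_add_not (w := w) (R := G.Adj) (A := A) (B := S')
    have k2 : pairMass w G.Adj A A + pairMass w G.Adj A S' ≤ mass w A * mass w S' := by
      rw [← pairMass_union_right hdisj, hunion, pairMass_eq_sum_mass]
      unfold mass at hmax ⊢
      rw [Finset.sum_mul]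
      refine Finset.sum_le_sum fun u hu => ?_
      exact mul_le_mul_of_nonneg_left (hmax u (Finset.mem_filter.1 hu).1) (hw u)
    linarith

/-- The weighted form of Turán's theorem. -/
lemma mul_pairMass_adj_le (hw : ∀ v, 0 ≤ w v) (q : ℕ) (S : Finset V)
    (hS : G.CliqueFreeOn S (q + 1)) :
    (q : ℚ) * pairMass w G.Adj S S ≤ (q - 1) * mass w S ^ 2 := by
  obtain ⟨c, hc, hle⟩ := exists_coloring_two_mul_inside_le hw q S hS
  have hT : ∀ u ∈ S, c u ∈ Finset.range q := fun u hu => Finset.mem_range.2 (hc u hu)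
  have h1 := pairMass_same_eq (w := w) (B := S) c (Finset.range q) hT
  have h2 := sum_mass_filter (w := w) c (Finset.range q) hT
  have h3 := sq_sum_le_card_mul_sum_sq (s := Finset.range q)
    (f := fun s => mass w (S.filter (c · = s)))
  rw [h2, Finset.card_range] at h3
  have h4 := pairMass_adj_eq (w := w) (A := S) (B := S) G c
  have h5 : 0 ≤ pairMass w (fun u v => G.Adj u v ∧ c u = c v) S S := pairMass_nonneg hw
  have h6 : pairMass w G.Adj S S ≤
      mass w S ^ 2 - ∑ s ∈ Finset.range q, mass w (S.filter (c · = s)) ^ 2 := by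
    simp only [← sq] at h1
    rw [h4, h1]
    nlinarith
  have := mul_le_mul_of_nonneg_left h6 (Nat.cast_nonneg (α := ℚ) q)
  linarith

end Weighted

/-! ### Cliques across parts and colours -/

section Transversal

open scoped Classical

variable {V ι κ : Type*} [DecidableEq κ] {w : V → ℚ} {G : SimpleGraph V}

/-- Sets of distinct colours, each of weight at least `η` and with little missing between
any two of them, contain a clique with as many vertices as there are sets: normalising each
set to weight one, this is Turán's theorem. -/
lemma not_cliqueFreeOn_of_dense (hw : ∀ v, 0 ≤ w v) (c : V → κ) (T : Finset κ)
    (hT : T.Nonempty) (B : κ → Finset V) (hc : ∀ s ∈ T, ∀ v ∈ B s, c v = s) {η ε : ℚ}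
    (hη : 0 < η) (hB : ∀ s ∈ T, η ≤ mass w (B s))
    (hmiss : ∀ s ∈ T, ∀ t ∈ T, s ≠ t → pairMass w (fun u v => ¬ G.Adj u v) (B s) (B t) ≤ ε)
    (hε : (T.card : ℚ) ^ 2 * ε < η ^ 2) {Z : Set V} (hZ : ∀ s ∈ T, ∀ v ∈ B s, v ∈ Z) :
    ¬ G.CliqueFreeOn Z T.card := by
  intro hfree
  obtain ⟨q, hq⟩ : ∃ q, T.card = q + 1 :=
    ⟨T.card - 1, (Nat.sub_add_cancel hT.card_pos).symm⟩
  have hε0 : 0 ≤ η ^ 2 - ε := by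
    rcases le_or_gt 0 ε with h | h
    · have : (1 : ℚ) ≤ (T.card : ℚ) ^ 2 := by
        rw [hq]; push_cast; nlinarith [Nat.cast_nonneg (α := ℚ) q]
      nlinarith
    · nlinarith [sq_nonneg η]
  set w' : V → ℚ := fun v => w v / mass w (B (c v)) with hw'
  have hw'0 : ∀ v, 0 ≤ w' v := fun v => div_nonneg (hw v) (mass_nonneg hw)
  set S := T.biUnion B with hS
  have hdisj : (T : Set κ).PairwiseDisjoint B := by
    intro s hs t ht hst
    refine Finset.disjoint_left.2 fun v hv hv' => hst ?_
    rw [← hc s hs v hv, hc t ht v hv']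
  have hfreeS : G.CliqueFreeOn S (q + 1) := by
    rw [← hq]
    refine SimpleGraph.CliqueFreeOn.subset G ?_ hfree
    intro v hv
    obtain ⟨s, hs, hv⟩ := Finset.mem_biUnion.1 (Finset.mem_coe.1 hv)
    exact hZ s hs v hv
  have hpos : ∀ s ∈ T, 0 < mass w (B s) := fun s hs => hη.trans_le (hB s hs)
  have hmass : ∀ s ∈ T, mass w' (B s) = 1 := by
    intro s hs
    have : mass w' (B s) = ∑ v ∈ B s, w v / mass w (B s) :=
      Finset.sum_congr rfl fun v hv => by simp only [hw', hc s hs v hv]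
    rw [this, ← Finset.sum_div]
    exact div_self (hpos s hs).ne'
  have hmassS : mass w' S = q + 1 := by
    have : mass w' S = ∑ s ∈ T, mass w' (B s) := Finset.sum_biUnion hdisj
    rw [this, Finset.sum_congr rfl hmass]
    simp [hq]
  have hpair : ∀ s ∈ T, ∀ t ∈ T, s ≠ t → 1 - ε / η ^ 2 ≤ pairMass w' G.Adj (B s) (B t) := by
    intro s hs t ht hst
    have h1 : pairMass w' (fun u v => ¬ G.Adj u v) (B s) (B t) =
        pairMass w (fun u v => ¬ G.Adj u v) (B s) (B t) / (mass w (B s) * mass w (B t)) := by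
      unfold pairMass
      rw [Finset.sum_div]
      refine Finset.sum_congr rfl fun u hu => ?_
      rw [Finset.sum_div]
      refine Finset.sum_congr rfl fun v hv => ?_
      by_cases h : G.Adj u v
      · simp [h]
      · simp only [hw', h, hc s hs u hu, hc t ht v hv, not_false_eq_true, if_true]
        rw [div_mul_div_comm]
    have h2 := pairMass_add_not (w := w') (R := G.Adj) (A := B s) (B := B t)
    rw [hmass s hs, hmass t ht, h1] at h2
    have h3 : pairMass w (fun u v => ¬ G.Adj u v) (B s) (B t) / (mass w (B s) * mass w (B t))
        ≤ ε / η ^ 2 := by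
      have hε' : 0 ≤ ε := (pairMass_nonneg hw).trans (hmiss s hs t ht hst)
      refine div_le_div₀ hε' (hmiss s hs t ht hst) (by positivity) ?_
      rw [sq]
      exact mul_le_mul (hB s hs) (hB t ht) hη.le (hpos s hs).le
    linarith
  have hsum : ((q : ℚ) + 1) * q * (1 - ε / η ^ 2) ≤ pairMass w' G.Adj S S := by
    rw [hS, pairMass_biUnion hdisj]
    have e2 : ∀ s ∈ T, (q : ℚ) * (1 - ε / η ^ 2) ≤ ∑ t ∈ T, pairMass w' G.Adj (B s) (B t) := by
      intro s hs
      calc (q : ℚ) * (1 - ε / η ^ 2) = ∑ t ∈ T.erase s, (1 - ε / η ^ 2) := by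
            rw [Finset.sum_const, Finset.card_erase_of_mem hs, hq]; simp
        _ ≤ ∑ t ∈ T.erase s, pairMass w' G.Adj (B s) (B t) :=
            Finset.sum_le_sum fun t ht => hpair s hs t (Finset.mem_of_mem_erase ht)
              (Finset.ne_of_mem_erase ht).symm
        _ ≤ _ := Finset.sum_le_sum_of_subset_of_nonneg (Finset.erase_subset _ _)
              fun t _ _ => pairMass_nonneg hw'0
    calc ((q : ℚ) + 1) * q * (1 - ε / η ^ 2) = ∑ s ∈ T, (q : ℚ) * (1 - ε / η ^ 2) := by
          rw [Finset.sum_const, hq]; simp; ring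
      _ ≤ _ := Finset.sum_le_sum e2
  have hturan := mul_pairMass_adj_le hw'0 q S hfreeS
  rw [hmassS] at hturan
  have hq0 : (0 : ℚ) ≤ q := Nat.cast_nonneg q
  have h1 : (q : ℚ) * (((q : ℚ) + 1) * q * (1 - ε / η ^ 2)) ≤ (q - 1) * (q + 1) ^ 2 :=
    (mul_le_mul_of_nonneg_left hsum hq0).trans hturan
  have h2 : ((q : ℚ) + 1) ^ 2 * (ε / η ^ 2) < 1 := by
    rw [← mul_div_assoc, div_lt_one (by positivity)]
    rw [hq] at hε
    push_cast at hε
    exact hε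
  have h3 : (q : ℚ) ^ 2 * (1 - ε / η ^ 2) ≤ (q - 1) * (q + 1) := by
    have : ((q : ℚ) + 1) * ((q : ℚ) ^ 2 * (1 - ε / η ^ 2)) ≤ (q + 1) * ((q - 1) * (q + 1)) := by
      linarith
    exact le_of_mul_le_mul_left this (by positivity)
  rcases le_or_gt 0 (ε / η ^ 2) with h | h <;> nlinarith

/-- Suppose that hardly anything is missing between any two of the parts in `N`, and that `Z`
contains no clique with one vertex for each colour in `T`. Then `Z` meets one of these colours
substantially in fewer than `#T` of the parts. Otherwise Hall's theorem provides distinct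
parts in which `Z` meets the different colours, and these sets contain a clique. -/
lemma exists_colour_few_hits (hw : ∀ v, 0 ≤ w v) (c : V → κ) (P : ι → Finset V)
    (N : Finset ι) {η ε : ℚ} (hη : 0 < η)
    (hN : ∀ i ∈ N, ∀ j ∈ N, i ≠ j →
      pairMass w (fun u v => ¬ G.Adj u v ∧ c u ≠ c v) (P i) (P j) ≤ ε)
    (T : Finset κ) (hT : T.Nonempty) (hε : (T.card : ℚ) ^ 2 * ε < η ^ 2) {Z : Set V}
    (hZ : G.CliqueFreeOn Z T.card) :
    ∃ s ∈ T, (N.filter fun h =>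
      η ≤ mass w ((P h).filter fun v => c v = s ∧ v ∈ Z)).card < T.card := by
  by_contra hcon
  push Not at hcon
  set H : T → Finset ι := fun s => N.filter fun h =>
      η ≤ mass w ((P h).filter fun v => c v = (s : κ) ∧ v ∈ Z) with hH
  obtain ⟨f, hf, hfH⟩ := (Finset.all_card_le_biUnion_card_iff_exists_injective H).1 (by
    intro T'
    rcases T'.eq_empty_or_nonempty with rfl | ⟨s, hs⟩
    · simp
    calc T'.card ≤ T.card := by
          simpa using Finset.card_le_univ T'
      _ ≤ (H s).card := hcon s s.2
      _ ≤ (T'.biUnion H).card := Finset.card_le_card (Finset.subset_biUnion_of_mem H hs))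
  let B : κ → Finset V := fun s =>
    if hs : s ∈ T then (P (f ⟨s, hs⟩)).filter fun v => c v = s ∧ v ∈ Z else ∅
  have hB : ∀ s (hs : s ∈ T), B s = (P (f ⟨s, hs⟩)).filter fun v => c v = s ∧ v ∈ Z :=
    fun s hs => by simp [B, hs]
  refine not_cliqueFreeOn_of_dense (G := G) hw c T hT B ?_ hη ?_ (ε := ε) ?_ hε ?_ hZ
  · intro s hs v hv
    rw [hB s hs] at hv
    exact (Finset.mem_filter.1 hv).2.1
  · intro s hs
    rw [hB s hs]
    exact (Finset.mem_filter.1 (hfH ⟨s, hs⟩)).2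
  · intro s hs t ht hst
    rw [hB s hs, hB t ht]
    refine le_trans ?_ (hN _ (Finset.mem_filter.1 (hfH ⟨s, hs⟩)).1 _
      (Finset.mem_filter.1 (hfH ⟨t, ht⟩)).1 fun h => hst ?_)
    · refine pairMass_mono hw (Finset.filter_subset _ _) (Finset.filter_subset _ _) ?_
      intro u hu v hv huv
      refine ⟨huv, ?_⟩
      rw [(Finset.mem_filter.1 hu).2.1, (Finset.mem_filter.1 hv).2.1]
      exact hst
    · exact congrArg Subtype.val (hf h)
  · intro s hs v hv
    rw [hB s hs] at hv
    exact (Finset.mem_filter.1 hv).2.2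

end Transversal

/-! ### Approximate structure -/

section Approximate

open scoped Classical

/-- A weighted multipartite graph whose parts `P i` have weight one each, with density at
least `1 - 1 / m` between any two parts. -/
structure IsDense {V ι : Type*} (G : SimpleGraph V) (w : V → ℚ) (P : ι → Finset V)
    (m : ℕ) : Prop where
  pos : ∀ v, 0 < w v
  mass_part : ∀ i, mass w (P i) = 1
  disjoint : ∀ i j, i ≠ j → Disjoint (P i) (P j)
  independent : ∀ i, ∀ u ∈ P i, ∀ v ∈ P i, ¬ G.Adj u v
  dense : ∀ i j, i ≠ j → 1 - 1 / (m : ℚ) ≤ pairMass w G.Adj (P i) (P j)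

variable {V ι κ : Type*} {G : SimpleGraph V} {w : V → ℚ} {P : ι → Finset V} {m : ℕ}

namespace IsDense

lemma nonneg (h : IsDense G w P m) (v : V) : 0 ≤ w v := (h.pos v).le

/-- For any colouring, few pairs of the same colour and few missing pairs are available
between two parts, unless there are monochromatic edges. -/
lemma same_add_miss_le (h : IsDense G w P m) (c : V → κ) {i j : ι} (hij : i ≠ j) :
    pairMass w (fun u v => c u = c v) (P i) (P j) +
      pairMass w (fun u v => ¬ G.Adj u v ∧ c u ≠ c v) (P i) (P j) ≤
      1 / (m : ℚ) + pairMass w (fun u v => G.Adj u v ∧ c u = c v) (P i) (P j) := by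
  have h1 := h.dense i j hij
  rw [pairMass_adj_eq G c, h.mass_part, h.mass_part] at h1
  linarith

lemma sum_colour [DecidableEq κ] [Fintype κ] (h : IsDense G w P m) (c : V → κ) (i : ι) :
    ∑ s, mass w ((P i).filter (c · = s)) = 1 := by
  rw [sum_mass_filter c Finset.univ (by simp), h.mass_part]

/-- In a suitable `m`-colouring, the total weight of monochromatic edges and missing pairs
is linear in the number of parts. -/
lemma exists_coloring [Fintype ι] (h : IsDense G w P m) (hm : 0 < m)
    (hG : G.CliqueFree (m + 1)) :
    ∃ c : V → Fin m, ∑ i, ∑ j,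
      (pairMass w (fun u v => G.Adj u v ∧ c u = c v) (P i) (P j) +
        pairMass w (fun u v => ¬ G.Adj u v ∧ c u ≠ c v) (P i) (P j)) ≤
      3 * (Fintype.card ι : ℚ) := by
  set S := Finset.univ.biUnion P with hS
  have hdisj : ((Finset.univ : Finset ι) : Set ι).PairwiseDisjoint P :=
    fun i _ j _ hij => h.disjoint i j hij
  obtain ⟨c₀, hc₀, hle₀⟩ := exists_coloring_two_mul_inside_le (w := w) h.nonneg m S
    (SimpleGraph.CliqueFree.cliqueFreeOn G hG)
  let c : V → Fin m := fun v => ⟨c₀ v % m, Nat.mod_lt _ hm⟩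
  have hc : ∀ u ∈ S, ∀ v ∈ S, (c u = c v ↔ c₀ u = c₀ v) := by
    intro u hu v hv
    simp only [c, Fin.mk.injEq, Nat.mod_eq_of_lt (hc₀ u hu), Nat.mod_eq_of_lt (hc₀ v hv)]
  have hle : 2 * pairMass w (fun u v => G.Adj u v ∧ c u = c v) S S ≤
          pairMass w (fun u v => ¬ G.Adj u v ∧ c u ≠ c v) S S := by
    rw [pairMass_congr (R' := fun u v => G.Adj u v ∧ c₀ u = c₀ v)
        fun u hu v hv => by rw [hc u hu v hv],
      pairMass_congr (R := fun u v => ¬ G.Adj u v ∧ c u ≠ c v)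
        (R' := fun u v => ¬ G.Adj u v ∧ c₀ u ≠ c₀ v)
        fun u hu v hv => by rw [Ne, hc u hu v hv]]
    exact hle₀
  refine ⟨c, ?_⟩
  have hsum : ∑ i, ∑ j,
      (pairMass w (fun u v => G.Adj u v ∧ c u = c v) (P i) (P j) +
        pairMass w (fun u v => ¬ G.Adj u v ∧ c u ≠ c v) (P i) (P j)) =
      pairMass w (fun u v => G.Adj u v ∧ c u = c v) S S +
        pairMass w (fun u v => ¬ G.Adj u v ∧ c u ≠ c v) S S := by
    rw [hS, pairMass_biUnion hdisj, pairMass_biUnion hdisj]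
    simp only [Finset.sum_add_distrib]
  rw [hsum]
  set ℓ : ℚ := (Fintype.card ι : ℚ) with hℓ
  have hmassS : mass w S = ℓ := by
    have : mass w S = ∑ i, mass w (P i) := Finset.sum_biUnion hdisj
    rw [this]
    simp [h.mass_part, hℓ]
  have hsame : ℓ ^ 2 / m ≤ pairMass w (fun u v => c u = c v) S S := by
    rw [pairMass_same_eq c Finset.univ (by simp)]
    have h3 := sq_sum_le_card_mul_sum_sq (s := (Finset.univ : Finset (Fin m)))
      (f := fun s => mass w (S.filter (c · = s)))
    rw [sum_mass_filter c Finset.univ (by simp), hmassS, Finset.card_univ,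
      Fintype.card_fin] at h3
    simp only [← sq]
    rw [div_le_iff₀' (by exact_mod_cast hm)]
    exact h3
  have hadj : ℓ * (ℓ - 1) * (1 - 1 / m) ≤ pairMass w G.Adj S S := by
    rw [hS, pairMass_biUnion hdisj]
    have e2 : ∀ i : ι, (ℓ - 1) * (1 - 1 / (m : ℚ)) ≤ ∑ j, pairMass w G.Adj (P i) (P j) := by
      intro i
      calc (ℓ - 1) * (1 - 1 / (m : ℚ)) = ∑ j ∈ Finset.univ.erase i, (1 - 1 / (m : ℚ)) := by
            rw [Finset.sum_const, Finset.card_erase_of_mem (Finset.mem_univ i), nsmul_eq_mul,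
              Nat.cast_sub (Finset.card_pos.2 ⟨i, Finset.mem_univ i⟩)]
            simp [hℓ]
        _ ≤ ∑ j ∈ Finset.univ.erase i, pairMass w G.Adj (P i) (P j) :=
            Finset.sum_le_sum fun j hj => h.dense i j (Finset.ne_of_mem_erase hj).symm
        _ ≤ _ := Finset.sum_le_sum_of_subset_of_nonneg (Finset.erase_subset _ _)
              fun j _ _ => pairMass_nonneg h.nonneg
    calc ℓ * (ℓ - 1) * (1 - 1 / m) = ∑ i : ι, (ℓ - 1) * (1 - 1 / (m : ℚ)) := by
          simp [hℓ, mul_assoc]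
      _ ≤ _ := Finset.sum_le_sum fun i _ => e2 i
  rw [pairMass_adj_eq G c, hmassS] at hadj
  have hℓ0 : 0 ≤ ℓ := Nat.cast_nonneg _
  have hm' : 0 ≤ 1 / (m : ℚ) := by positivity
  have h1 : ℓ * (ℓ - 1) * (1 - 1 / m) = ℓ ^ 2 - ℓ ^ 2 / m - ℓ + ℓ * (1 / m) := by ring
  have h2 := mul_nonneg hℓ0 hm'
  linarith

end IsDense

/-- If a nonnegative symmetric function on pairs has a sum linear in the number of points,
then it is small on all pairs from a large set: this is Turán's theorem for the graph of the
pairs where it is small. -/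
lemma exists_large_pairwise_le [Fintype ι] (f : ι → ι → ℚ) (hf : ∀ i j, 0 ≤ f i j)
    (hsymm : ∀ i j, f i j = f j i) {C ε : ℚ} (hC : 0 ≤ C) (hε : 0 < ε)
    (hsum : ∑ i, ∑ j, f i j ≤ C * Fintype.card ι) (q : ℕ)
    (hq : (q : ℚ) * (1 + C / ε) < Fintype.card ι) :
    ∃ N : Finset ι, N.card = q + 1 ∧ ∀ i ∈ N, ∀ j ∈ N, i ≠ j → f i j ≤ ε := by
  by_contra hcon
  push Not at hcon
  let R : SimpleGraph ι :=
    { Adj := fun i j => i ≠ j ∧ f i j ≤ ε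
      symm := ⟨fun i j h => ⟨h.1.symm, hsymm i j ▸ h.2⟩⟩
      loopless := ⟨fun i h => h.1 rfl⟩ }
  have hfree : R.CliqueFreeOn (Finset.univ : Finset ι) (q + 1) := by
    intro N _ hN
    obtain ⟨i, hi, j, hj, hij, hlt⟩ := hcon N hN.card_eq
    exact absurd (hN.isClique hi hj hij).2 (not_le.2 hlt)
  have h1 := mul_pairMass_adj_le (w := fun _ => 1) (by simp) q Finset.univ hfree
  have h2 := pairMass_add_not (w := fun _ => 1) (R := R.Adj) (A := Finset.univ)
    (B := Finset.univ)
  have h3 : mass (fun _ : ι => (1 : ℚ)) Finset.univ = Fintype.card ι := by simp [mass]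
  rw [h3] at h1 h2
  have h4 : pairMass (fun _ => 1) (fun i j => ¬ R.Adj i j) Finset.univ Finset.univ ≤
      Fintype.card ι * (1 + C / ε) := by
    calc pairMass (fun _ => 1) (fun i j => ¬ R.Adj i j) Finset.univ Finset.univ
        ≤ ∑ i : ι, ∑ j : ι, ((if i = j then 1 else 0) + f i j / ε) := by
          refine Finset.sum_le_sum fun i _ => Finset.sum_le_sum fun j _ => ?_
          have h0 : 0 ≤ f i j / ε := div_nonneg (hf i j) hε.le
          by_cases hij : i = j
          · subst hij
            simp [R, h0]
          · by_cases hle : f i j ≤ ε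
            · simp [R, hij, hle, h0]
            · have : 1 ≤ f i j / ε := by rw [le_div_iff₀ hε]; linarith
              simp [R, hij, hle, this]
      _ = Fintype.card ι + (∑ i, ∑ j, f i j) / ε := by
          simp [Finset.sum_add_distrib, Finset.sum_div]
      _ ≤ Fintype.card ι + C * Fintype.card ι / ε := by
          gcongr
      _ = _ := by ring
  set ℓ : ℚ := (Fintype.card ι : ℚ)
  have hℓ0 : 0 ≤ ℓ := Nat.cast_nonneg _
  have hq0 : (0 : ℚ) ≤ q := Nat.cast_nonneg _
  have h5 := mul_le_mul_of_nonneg_left h4 hq0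
  have h6 : ℓ ^ 2 ≤ ℓ * (q * (1 + C / ε)) := by nlinarith
  have h0 : 0 < ℓ := lt_of_le_of_lt (by positivity) hq
  nlinarith

/-- The pigeonhole principle for vectors with entries in the unit interval. -/
lemma exists_large_close [Fintype κ] (a : ι → κ → ℚ) (h0 : ∀ i s, 0 ≤ a i s)
    (h1 : ∀ i s, a i s ≤ 1) (K n : ℕ) (hK : 0 < K) (N : Finset ι)
    (hN : (K + 1) ^ Fintype.card κ * n ≤ N.card) :
    ∃ N' ⊆ N, n ≤ N'.card ∧ ∀ i ∈ N', ∀ j ∈ N', ∀ s, a i s - a j s ≤ 1 / (K : ℚ) := by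
  let g : ι → κ → Fin (K + 1) := fun i s => ⟨⌊(K : ℚ) * a i s⌋₊, by
    refine Nat.lt_succ_of_le (Nat.floor_le_of_le ?_)
    have := h1 i s
    have hK' : (0 : ℚ) < K := by exact_mod_cast hK
    nlinarith⟩
  obtain ⟨y, _, hy⟩ := Finset.exists_le_card_fiber_of_mul_le_card_of_maps_to (s := N)
    (t := Finset.univ) (f := g) (n := n) (by simp) Finset.univ_nonempty (by
      simpa [Finset.card_univ] using hN)
  refine ⟨_, Finset.filter_subset _ _, hy, ?_⟩
  intro i hi j hj s
  have hij : ⌊(K : ℚ) * a i s⌋₊ = ⌊(K : ℚ) * a j s⌋₊ := by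
    have e := (Finset.mem_filter.1 hi).2.trans (Finset.mem_filter.1 hj).2.symm
    exact congrArg Fin.val (congrFun e s)
  have hK' : (0 : ℚ) < K := by exact_mod_cast hK
  have e1 := Nat.lt_floor_add_one ((K : ℚ) * a i s)
  have e2 := Nat.floor_le (mul_nonneg hK'.le (h0 j s))
  rw [hij] at e1
  rw [le_div_iff₀ hK']
  linarith

/-- The conclusion of the approximate part of the argument: between any two of the parts in
`N` the colouring `c` has few monochromatic edges and few missing pairs, and each part in `N`
is split by `c` into nearly equal colour classes. The bound `1 / (4096 * m ^ 4)` is chosen to be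
small compared with the square of `1 / (32 * m)`, the weight from which on a neighbourhood counts
as substantial, even after multiplication by `m ^ 2`. -/
structure IsNearTuran (G : SimpleGraph V) (w : V → ℚ) (P : ι → Finset V) (c : V → Fin m)
    (N : Finset ι) : Prop where
  inside : ∀ i ∈ N, ∀ j ∈ N, i ≠ j →
    pairMass w (fun u v => G.Adj u v ∧ c u = c v) (P i) (P j) ≤ 1 / (4096 * m ^ 4)
  miss : ∀ i ∈ N, ∀ j ∈ N, i ≠ j →
    pairMass w (fun u v => ¬ G.Adj u v ∧ c u ≠ c v) (P i) (P j) ≤ 1 / (4096 * m ^ 4)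
  balanced : ∀ i ∈ N, ∀ s, |mass w ((P i).filter (c · = s)) - 1 / m| ≤ 1 / (8 * m)

/-- If the colour classes of two parts have nearly the same sizes, then these sizes are nearly
`1 / m`: by the density condition, the inner product of the two vectors of deviations from `1 / m`
is nearly nonpositive, and it nearly equals the squared norm of either of them. -/
lemma IsDense.abs_sub_le_of_close (h : IsDense G w P m) (hm : 0 < m) (c : V → Fin m) {i j : ι}
    (hij : i ≠ j)
    (hin : pairMass w (fun u v => G.Adj u v ∧ c u = c v) (P i) (P j) ≤ 1 / (4096 * m ^ 4))
    (hclose : ∀ s, mass w ((P i).filter (c · = s)) - mass w ((P j).filter (c · = s)) ≤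
      1 / (128 * m ^ 2)) (s : Fin m) :
    |mass w ((P i).filter (c · = s)) - 1 / m| ≤ 1 / (8 * m) := by
  have hm' : (1 : ℚ) ≤ m := by exact_mod_cast hm
  have hm0 : (0 : ℚ) < m := by linarith
  set a : Fin m → ℚ := fun s => mass w ((P i).filter (c · = s)) with ha
  set b : Fin m → ℚ := fun s => mass w ((P j).filter (c · = s)) with hb
  have ha1 : ∑ s, a s = 1 := h.sum_colour c i
  have ha0 : ∀ s, 0 ≤ a s := fun s => mass_nonneg h.nonneg
  have hab : ∑ s, a s * b s ≤ 1 / m + 1 / (4096 * m ^ 4) := by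
    have h1 := h.same_add_miss_le c hij
    have h2 : 0 ≤ pairMass w (fun u v => ¬ G.Adj u v ∧ c u ≠ c v) (P i) (P j) :=
      pairMass_nonneg h.nonneg
    rw [pairMass_same_eq c Finset.univ (by simp)] at h1
    linarith
  have haa : ∑ s, a s * (a s - b s) ≤ 1 / (128 * m ^ 2) := by
    calc ∑ s, a s * (a s - b s) ≤ ∑ s, a s * (1 / (128 * m ^ 2)) :=
          Finset.sum_le_sum fun s _ => mul_le_mul_of_nonneg_left (hclose s) (ha0 s)
      _ = _ := by rw [← Finset.sum_mul, ha1, one_mul]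
  have hsq : ∑ s, (a s - 1 / m) ^ 2 =
      ∑ s, a s * b s + ∑ s, a s * (a s - b s) - 1 / m := by
    have e : ∀ s, (a s - 1 / m) ^ 2 =
        a s * b s + a s * (a s - b s) - 2 / m * a s + 1 / m * (1 / m) := fun s => by ring
    simp only [e, Finset.sum_add_distrib, Finset.sum_sub_distrib, ← Finset.mul_sum, ha1,
      Finset.sum_const, Finset.card_univ, Fintype.card_fin, nsmul_eq_mul]
    field_simp
    ring
  have h1 : (a s - 1 / m) ^ 2 ≤ ∑ s, (a s - 1 / m) ^ 2 :=
    Finset.single_le_sum (f := fun s => (a s - 1 / m) ^ 2) (fun s _ => sq_nonneg _)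
      (Finset.mem_univ s)
  have h2 : (1 : ℚ) / (4096 * m ^ 4) ≤ 1 / (128 * m ^ 2) := by
    apply one_div_le_one_div_of_le (by positivity)
    have : (1 : ℚ) ≤ m ^ 2 := one_le_pow₀ hm'
    nlinarith
  have h3 : (1 : ℚ) / (128 * m ^ 2) + 1 / (128 * m ^ 2) = (1 / (8 * m)) ^ 2 := by
    field_simp
    norm_num
  refine abs_le_of_sq_le_sq ?_ (by positivity)
  linarith

/-- Among sufficiently many parts there are many that look like a complete `m`-partite graph
with balanced classes. -/
lemma exists_isNearTuran (m n : ℕ) (hm : 0 < m) (hn : 2 ≤ n) :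
    ∃ L : ℕ, ∀ (V ι : Type*) [Fintype ι] (G : SimpleGraph V) (w : V → ℚ) (P : ι → Finset V),
      L ≤ Fintype.card ι → IsDense G w P m → G.CliqueFree (m + 1) →
      ∃ (c : V → Fin m) (N : Finset ι), n ≤ N.card ∧ IsNearTuran G w P c N := by
  -- Turán's theorem provides `q + 1` parts, and the pigeonhole principle leaves `n` of them.
  set q : ℕ := (128 * m ^ 2 + 1) ^ m * n with hq
  refine ⟨q * (1 + 3 * (4096 * m ^ 4)) + 1, ?_⟩
  intro V ι _ G w P hL h hG
  have hm0 : (0 : ℚ) < m := by exact_mod_cast hm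
  obtain ⟨c, hc⟩ := h.exists_coloring hm hG
  have hin0 : ∀ i j, 0 ≤ pairMass w (fun u v => G.Adj u v ∧ c u = c v) (P i) (P j) :=
    fun i j => pairMass_nonneg h.nonneg
  have hmiss0 : ∀ i j, 0 ≤ pairMass w (fun u v => ¬ G.Adj u v ∧ c u ≠ c v) (P i) (P j) :=
    fun i j => pairMass_nonneg h.nonneg
  obtain ⟨N, hN, hNle⟩ := exists_large_pairwise_le
    (fun i j => pairMass w (fun u v => G.Adj u v ∧ c u = c v) (P i) (P j) +
        pairMass w (fun u v => ¬ G.Adj u v ∧ c u ≠ c v) (P i) (P j))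
    (fun i j => add_nonneg (hin0 i j) (hmiss0 i j))
    (fun i j => by
      rw [pairMass_comm (R := fun u v => G.Adj u v ∧ c u = c v)
          (fun u v huv => ⟨huv.1.symm, huv.2.symm⟩),
        pairMass_comm (R := fun u v => ¬ G.Adj u v ∧ c u ≠ c v)
          (fun u v huv => ⟨fun h' => huv.1 h'.symm, huv.2.symm⟩)])
    (C := 3) (ε := 1 / (4096 * (m : ℚ) ^ 4)) (by norm_num) (by positivity) hc q (by
      have : ((q * (1 + 3 * (4096 * m ^ 4)) + 1 : ℕ) : ℚ) ≤ Fintype.card ι := by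
        exact_mod_cast hL
      push_cast at this
      rw [div_div_eq_mul_div, div_one]
      linarith)
  obtain ⟨N', hN'N, hcard, hclose⟩ := exists_large_close
    (fun i s => mass w ((P i).filter (c · = s))) (fun i s => mass_nonneg h.nonneg)
    (fun i s => (mass_mono h.nonneg (Finset.filter_subset _ _)).trans (h.mass_part i).le)
    (128 * m ^ 2) n (by positivity) N (by rw [hN, Fintype.card_fin]; omega)
  refine ⟨c, N', hcard, ?_, ?_, ?_⟩
  · intro i hi j hj hij
    linarith [hNle i (hN'N hi) j (hN'N hj) hij, hmiss0 i j]
  · intro i hi j hj hij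
    linarith [hNle i (hN'N hi) j (hN'N hj) hij, hin0 i j]
  · intro i hi s
    obtain ⟨j, hj, hji⟩ := Finset.exists_mem_ne (by omega : 1 < N'.card) i
    refine h.abs_sub_le_of_close hm c hji.symm ?_ (fun s => ?_) s
    · linarith [hNle i (hN'N hi) j (hN'N hj) hji.symm, hmiss0 i j]
    · have := hclose i hi j hj s
      push_cast at this
      exact this

end Approximate

/-! ### Chebyshev's sum inequality and counting -/

section Chebyshev

lemma exists_antitone_perm {m : ℕ} (f : Fin m → ℚ) :
    ∃ τ : Equiv.Perm (Fin m), Antitone (f ∘ τ) := by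
  refine ⟨Tuple.sort fun s => -f s, fun r r' h => ?_⟩
  have := Tuple.monotone_sort (fun s => -f s) h
  simpa using this

lemma mul_sub_nonneg_of_antitone {m : ℕ} {f g : Fin m → ℚ} (τ : Equiv.Perm (Fin m))
    (hf : Antitone (f ∘ τ)) (hg : Antitone (g ∘ τ)) (s t : Fin m) :
    0 ≤ (f s - f t) * (g s - g t) := by
  obtain ⟨p, rfl⟩ := τ.surjective s
  obtain ⟨q, rfl⟩ := τ.surjective t
  rcases le_total p q with h | h
  · exact mul_nonneg (sub_nonneg.2 (hf h)) (sub_nonneg.2 (hg h))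
  · exact mul_nonneg_of_nonpos_of_nonpos (sub_nonpos.2 (hf h)) (sub_nonpos.2 (hg h))

lemma sum_sum_mul_sub {κ : Type*} [Fintype κ] (f g : κ → ℚ) :
    ∑ s, ∑ t, (f s - f t) * (g s - g t) =
      2 * (Fintype.card κ * ∑ s, f s * g s - (∑ s, f s) * ∑ s, g s) := by
  have e : ∀ s t, (f s - f t) * (g s - g t) =
      f s * g s + f t * g t - f s * g t - f t * g s := fun s t => by ring
  simp only [e, Finset.sum_sub_distrib, Finset.sum_add_distrib, ← Finset.mul_sum,
    ← Finset.sum_mul, Finset.sum_const, Finset.card_univ, nsmul_eq_mul]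
  have e' : ∑ s, f s * (Fintype.card κ * g s) = Fintype.card κ * ∑ s, f s * g s := by
    rw [Finset.mul_sum]
    exact Finset.sum_congr rfl fun s _ => by ring
  linarith

/-- Chebyshev's sum inequality for similarly ordered vectors of sum one. -/
lemma one_div_card_le_sum_mul {κ : Type*} [Fintype κ] {f g : κ → ℚ}
    (hfg : ∀ s t, 0 ≤ (f s - f t) * (g s - g t)) (hf : ∑ s, f s = 1) (hg : ∑ s, g s = 1) :
    1 / (Fintype.card κ : ℚ) ≤ ∑ s, f s * g s := by
  have h1 := sum_sum_mul_sub f g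
  have h2 : 0 ≤ ∑ s, ∑ t, (f s - f t) * (g s - g t) :=
    Finset.sum_nonneg fun s _ => Finset.sum_nonneg fun t _ => hfg s t
  rw [hf, hg] at h1
  have h3 : 1 ≤ (Fintype.card κ : ℚ) * ∑ s, f s * g s := by linarith
  rcases (Nat.cast_nonneg (α := ℚ) (Fintype.card κ)).eq_or_lt with h | h
  · rw [← h] at h3; linarith
  · rwa [div_le_iff₀' h]

/-- Equality in Chebyshev's sum inequality forces one of the vectors to be constant. -/
lemma constant_of_sum_mul_le {κ : Type*} [Fintype κ] {f g : κ → ℚ}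
    (hfg : ∀ s t, 0 ≤ (f s - f t) * (g s - g t)) (hf : ∑ s, f s = 1) (hg : ∑ s, g s = 1)
    (h : ∑ s, f s * g s ≤ 1 / (Fintype.card κ : ℚ)) :
    (∀ s, f s = 1 / Fintype.card κ) ∨ ∀ s, g s = 1 / Fintype.card κ := by
  have hne : Nonempty κ := by
    by_contra hcon
    rw [not_nonempty_iff] at hcon
    simp at hf
  have hκ : (0 : ℚ) < Fintype.card κ := by exact_mod_cast Fintype.card_pos
  have h1 := sum_sum_mul_sub f g
  rw [hf, hg] at h1
  have h2 : (Fintype.card κ : ℚ) * ∑ s, f s * g s ≤ 1 := by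
    rwa [le_div_iff₀' hκ] at h
  have h3 : ∑ s, ∑ t, (f s - f t) * (g s - g t) = 0 :=
    le_antisymm (by linarith)
      (Finset.sum_nonneg fun s _ => Finset.sum_nonneg fun t _ => hfg s t)
  have h4 : ∀ s t, f s = f t ∨ g s = g t := by
    intro s t
    rw [Finset.sum_eq_zero_iff_of_nonneg
      fun s _ => Finset.sum_nonneg fun t _ => hfg s t] at h3
    have h5 := h3 s (Finset.mem_univ s)
    rw [Finset.sum_eq_zero_iff_of_nonneg fun t _ => hfg s t] at h5
    have h6 := h5 t (Finset.mem_univ t)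
    simpa [sub_eq_zero] using h6
  have hconst : ∀ {f : κ → ℚ}, ∑ s, f s = 1 → (∀ s t, f s = f t) →
      ∀ s, f s = 1 / Fintype.card κ := by
    intro f hf hc s
    rw [Finset.sum_congr rfl fun t _ => hc t s] at hf
    rw [eq_div_iff hκ.ne', mul_comm]
    simpa using hf
  by_cases hfc : ∀ s t, f s = f t
  · exact Or.inl (hconst hf hfc)
  by_cases hgc : ∀ s t, g s = g t
  · exact Or.inr (hconst hg hgc)
  push Not at hfc hgc
  obtain ⟨s, t, hst⟩ := hfc
  obtain ⟨u, v, huv⟩ := hgc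
  have := h4 s t
  have := h4 u v
  have := h4 s u
  have := h4 s v
  have := h4 t u
  have := h4 t v
  grind

end Chebyshev

section Counting

open scoped Classical

variable {V ι : Type*}

lemma card_sub_mul_le_sum {M X : Finset ι} {f : ι → ℚ} {θ : ℚ} (hθ : 0 ≤ θ)
    (h0 : ∀ i ∈ M, 0 ≤ f i) (h : ∀ i ∈ M, i ∉ X → θ ≤ f i) :
    ((M.card : ℚ) - X.card) * θ ≤ ∑ i ∈ M, f i := by
  have h1 : (M.card : ℚ) - X.card ≤ (M \ X).card := by
    have : M.card ≤ (M \ X).card + X.card := by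
      have := Finset.le_card_sdiff X M
      omega
    have : (M.card : ℚ) ≤ (M \ X).card + X.card := by exact_mod_cast this
    linarith
  calc ((M.card : ℚ) - X.card) * θ ≤ (M \ X).card * θ := mul_le_mul_of_nonneg_right h1 hθ
    _ = ∑ i ∈ M \ X, θ := by simp
    _ ≤ ∑ i ∈ M \ X, f i := Finset.sum_le_sum fun i hi =>
        h i (Finset.mem_sdiff.1 hi).1 (Finset.mem_sdiff.1 hi).2
    _ ≤ _ := Finset.sum_le_sum_of_subset_of_nonneg Finset.sdiff_subset fun i hi _ => h0 i hi

lemma sum_le_card_add_mul {M X : Finset ι} {f : ι → ℚ} {b : ℚ} (hb : 0 ≤ b)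
    (h1 : ∀ i ∈ M, f i ≤ 1) (h : ∀ i ∈ M, i ∉ X → f i ≤ b) :
    ∑ i ∈ M, f i ≤ X.card + M.card * b := by
  calc ∑ i ∈ M, f i ≤ ∑ i ∈ M, ((if i ∈ X then 1 else 0) + b) := by
        refine Finset.sum_le_sum fun i hi => ?_
        by_cases hX : i ∈ X
        · simp only [hX, if_true]; linarith [h1 i hi]
        · simpa [hX] using h i hi hX
    _ = (M ∩ X).card + M.card * b := by
        rw [Finset.sum_add_distrib, Finset.sum_ite_mem]; simp
    _ ≤ _ := by
        gcongr
        exact Finset.inter_subset_right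

variable {w : V → ℚ}

lemma mass_filter_biUnion {N : Finset ι} {P : ι → Finset V}
    (h : (N : Set ι).PairwiseDisjoint P) (p : V → Prop) [DecidablePred p] :
    mass w ((N.biUnion P).filter p) = ∑ i ∈ N, mass w ((P i).filter p) := by
  rw [Finset.filter_biUnion]
  exact Finset.sum_biUnion fun i hi j hj hij =>
    Finset.disjoint_filter_filter (h hi hj hij)

/-- If the two ends of every related pair have a large total value of `d`, and each vertex
is related to a set of weight at most `b`, then the weight of the related pairs is controlled
by the weighted sum of `d`. -/
lemma mul_pairMass_le_of_le_add (hw : ∀ v, 0 ≤ w v) {R : V → V → Prop}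
    [DecidableRel R] (hR : ∀ u v, R u v → R v u) {S : Finset V} {d : V → ℚ} (hd : ∀ v, 0 ≤ d v) {θ b : ℚ}
    (hθ : ∀ u ∈ S, ∀ v ∈ S, R u v → 2 * θ ≤ d u + d v)
    (hb : ∀ u ∈ S, mass w (S.filter (R u)) ≤ b) :
    θ * pairMass w R S S ≤ b * ∑ u ∈ S, w u * d u := by
  have e1 : ∑ u ∈ S, ∑ v ∈ S, (if R u v then w u * w v * d u else 0) =
      ∑ u ∈ S, w u * d u * mass w (S.filter (R u)) := by
    refine Finset.sum_congr rfl fun u _ => ?_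
    unfold mass
    rw [Finset.mul_sum, Finset.sum_filter]
    refine Finset.sum_congr rfl fun v _ => ?_
    by_cases h : R u v
    · simp only [h, if_true]; ring
    · simp [h]
  have e2 : ∑ u ∈ S, ∑ v ∈ S, (if R u v then w u * w v * d v else 0) =
      ∑ u ∈ S, ∑ v ∈ S, (if R u v then w u * w v * d u else 0) := by
    rw [Finset.sum_comm]
    refine Finset.sum_congr rfl fun u _ => Finset.sum_congr rfl fun v _ => ?_
    have : R u v ↔ R v u := ⟨hR _ _, hR _ _⟩
    simp only [this, mul_comm (w u)]
  have e3 : 2 * (θ * pairMass w R S S) ≤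
      ∑ u ∈ S, ∑ v ∈ S, (if R u v then w u * w v * d u else 0) +
      ∑ u ∈ S, ∑ v ∈ S, (if R u v then w u * w v * d v else 0) := by
    unfold pairMass
    rw [← mul_assoc, Finset.mul_sum, ← Finset.sum_add_distrib]
    refine Finset.sum_le_sum fun u hu => ?_
    rw [Finset.mul_sum, ← Finset.sum_add_distrib]
    refine Finset.sum_le_sum fun v hv => ?_
    split_ifs with h
    · have := mul_le_mul_of_nonneg_left (hθ u hu v hv h) (mul_nonneg (hw u) (hw v))
      linarith
    · simp
  have e4 : ∑ u ∈ S, w u * d u * mass w (S.filter (R u)) ≤ b * ∑ u ∈ S, w u * d u := by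
    rw [Finset.mul_sum]
    refine Finset.sum_le_sum fun u hu => ?_
    rw [mul_comm b]
    exact mul_le_mul_of_nonneg_left (hb u hu) (mul_nonneg (hw u) (hd u))
  linarith

end Counting

/-! ### Vertices of a nearly complete multipartite graph -/

section Exact

open scoped Classical

variable {V ι : Type*} {G : SimpleGraph V} {w : V → ℚ} {P : ι → Finset V} {m : ℕ}
  {c : V → Fin m} {N : Finset ι}

lemma cliqueFreeOn_neighborSet (hG : G.CliqueFree (m + 1)) (v : V) :
    G.CliqueFreeOn (G.neighborSet v) m := by
  have := SimpleGraph.CliqueFreeOn.of_succ G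
    (SimpleGraph.CliqueFree.cliqueFreeOn G (s := Set.univ) hG) (Set.mem_univ v)
  rwa [Set.univ_inter] at this

lemma cliqueFreeOn_common_neighbors (hG : G.CliqueFree (m + 1)) {u v : V} (huv : G.Adj u v) :
    G.CliqueFreeOn (G.neighborSet u ∩ G.neighborSet v) (m - 1) := by
  rcases m with _ | m
  · exact absurd hG (by
      intro h
      exact h {u} (by simp [SimpleGraph.isNClique_iff]))
  · exact SimpleGraph.CliqueFreeOn.of_succ G (cliqueFreeOn_neighborSet hG u) huv

namespace IsNearTuran

lemma le_mass (hN : IsNearTuran G w P c N) {h : ι} (hh : h ∈ N) (s : Fin m) :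
    7 / (8 * (m : ℚ)) ≤ mass w ((P h).filter (c · = s)) := by
  have h1 := neg_le_of_abs_le (hN.balanced h hh s)
  have : (7 : ℚ) / (8 * m) = 1 / m - 1 / (8 * m) := by
    rcases eq_or_ne (m : ℚ) 0 with h0 | h0
    · simp [h0]
    · field_simp; norm_num
  linarith

/-- A set `Z` without a clique of size `#T` has weight less than `1 / (32 * m)` in some colour
from `T`, in all but fewer than `#T` of the parts. -/
lemma exists_missed_colour (hN : IsNearTuran G w P c N) (hw : ∀ v, 0 ≤ w v)
    (T : Finset (Fin m)) (hT : T.Nonempty) {Z : Set V} (hZ : G.CliqueFreeOn Z T.card) :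
    ∃ s ∈ T, (N.filter fun h => 1 / (32 * (m : ℚ)) ≤
      mass w ((P h).filter fun v => c v = s ∧ v ∈ Z)).card < T.card := by
  have hm : (1 : ℚ) ≤ m := by
    obtain ⟨s, _⟩ := hT
    have := s.pos
    exact_mod_cast this
  refine exists_colour_few_hits hw c P N (by positivity) hN.miss T hT ?_ hZ
  have hc : (T.card : ℚ) ≤ m := by
    have := Finset.card_le_univ T
    rw [Fintype.card_fin] at this
    exact_mod_cast this
  have h1 : (T.card : ℚ) ^ 2 ≤ m ^ 2 := by gcongr
  calc (T.card : ℚ) ^ 2 * (1 / (4096 * (m : ℚ) ^ 4))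
      ≤ (m : ℚ) ^ 2 * (1 / (4096 * (m : ℚ) ^ 4)) := by gcongr
    _ = 1 / 4 * (1 / (32 * (m : ℚ))) ^ 2 := by field_simp; norm_num
    _ < (1 / (32 * (m : ℚ))) ^ 2 := by
      have : (0 : ℚ) < (1 / (32 * (m : ℚ))) ^ 2 := by positivity
      linarith

/-- The part of the colour class `t` in `P h` that lies outside `Z` is large, if `Z` meets
the colour class only slightly. -/
lemma le_mass_not_mem (hN : IsNearTuran G w P c N) {h : ι} (hh : h ∈ N) {t : Fin m}
    {Z : Set V} (hZ : mass w ((P h).filter fun v => c v = t ∧ v ∈ Z) < 1 / (32 * (m : ℚ))) :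
    27 / (32 * (m : ℚ)) ≤ mass w ((P h).filter fun v => c v = t ∧ v ∉ Z) := by
  have h1 : mass w ((P h).filter fun v => c v = t ∧ v ∈ Z) +
      mass w ((P h).filter fun v => c v = t ∧ v ∉ Z) = mass w ((P h).filter (c · = t)) := by
    unfold mass
    rw [← Finset.filter_filter, ← Finset.filter_filter]
    exact Finset.sum_filter_add_sum_filter_not _ _ _
  have h2 := hN.le_mass hh t
  have : (27 : ℚ) / (32 * m) = 7 / (8 * m) - 1 / (32 * m) := by
    rcases eq_or_ne (m : ℚ) 0 with h0 | h0
    · simp [h0]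
    · field_simp; norm_num
  linarith

/-- Let every vertex be recoloured with a colour in which it has few neighbours in almost
all parts. Then few vertices of each part change their colour, since such vertices miss many
pairs of distinct colours. -/
lemma mass_recoloured_le (hN : IsNearTuran G w P c N) (hP : IsDense G w P m) (hm : 0 < m)
    (hcard : 2 * m ≤ N.card) (σ : V → Fin m)
    (hσ : ∀ v, (N.filter fun h => 1 / (32 * (m : ℚ)) ≤
      mass w ((P h).filter fun x => c x = σ v ∧ x ∈ G.neighborSet v)).card < m)
    {i : ι} (hi : i ∈ N) :
    mass w ((P i).filter fun v => σ v ≠ c v) ≤ 1 / (32 * (m : ℚ)) := by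
  have hw := hP.nonneg
  have hm' : (1 : ℚ) ≤ m := by exact_mod_cast hm
  set n : ℚ := (N.card : ℚ) with hn
  have hn2 : 2 * (m : ℚ) ≤ n := by rw [hn]; exact_mod_cast hcard
  set B := (P i).filter fun v => σ v ≠ c v with hB
  have hv : ∀ v ∈ B, (n - m) * (27 / (32 * (m : ℚ))) ≤
      ∑ j ∈ N.erase i, mass w ((P j).filter fun x => ¬ G.Adj v x ∧ c v ≠ c x) := by
    intro v hv
    have hcv : σ v ≠ c v := (Finset.mem_filter.1 hv).2
    have h1 := card_sub_mul_le_sum (M := N.erase i) (X := N.filter fun h => 1 / (32 * (m : ℚ)) ≤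
      mass w ((P h).filter fun x => c x = σ v ∧ x ∈ G.neighborSet v))
      (f := fun j => mass w ((P j).filter fun x => ¬ G.Adj v x ∧ c v ≠ c x))
      (θ := 27 / (32 * (m : ℚ))) (by positivity) (fun j _ => mass_nonneg hw) (by
        intro j hj hjX
        have hjN := Finset.mem_of_mem_erase hj
        have hlt : mass w ((P j).filter fun x => c x = σ v ∧ x ∈ G.neighborSet v) <
            1 / (32 * (m : ℚ)) := by
          by_contra hcon
          exact hjX (Finset.mem_filter.2 ⟨hjN, not_lt.1 hcon⟩)
        refine (hN.le_mass_not_mem hjN hlt).trans (mass_mono hw ?_)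
        intro x hx
        rw [Finset.mem_filter] at hx ⊢
        exact ⟨hx.1, hx.2.2, by rw [hx.2.1]; exact hcv.symm⟩)
    refine le_trans (mul_le_mul_of_nonneg_right ?_ (by positivity)) h1
    have h2 : ((N.filter fun h => 1 / (32 * (m : ℚ)) ≤
      mass w ((P h).filter fun x => c x = σ v ∧ x ∈ G.neighborSet v)).card : ℚ) + 1 ≤ m := by
      exact_mod_cast hσ v
    rw [Finset.card_erase_of_mem hi, Nat.cast_sub (Finset.card_pos.2 ⟨i, hi⟩)]
    push_cast
    linarith
  have hsum : mass w B * ((n - m) * (27 / (32 * (m : ℚ)))) ≤ n * (1 / (4096 * m ^ 4)) := by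
    calc mass w B * ((n - m) * (27 / (32 * (m : ℚ))))
        ≤ ∑ v ∈ B, w v *
          ∑ j ∈ N.erase i, mass w ((P j).filter fun x => ¬ G.Adj v x ∧ c v ≠ c x) := by
          unfold mass
          rw [Finset.sum_mul]
          exact Finset.sum_le_sum fun v hvB => mul_le_mul_of_nonneg_left (hv v hvB) (hw v)
      _ = ∑ j ∈ N.erase i, pairMass w (fun u v => ¬ G.Adj u v ∧ c u ≠ c v) B (P j) := by
          simp only [pairMass_eq_sum_mass, Finset.mul_sum]
          rw [Finset.sum_comm]
      _ ≤ ∑ j ∈ N.erase i, 1 / (4096 * (m : ℚ) ^ 4) := by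
          refine Finset.sum_le_sum fun j hj => le_trans ?_
            (hN.miss i hi j (Finset.mem_of_mem_erase hj) (Finset.ne_of_mem_erase hj).symm)
          exact pairMass_mono hw (Finset.filter_subset _ _) subset_rfl fun _ _ _ _ h => h
      _ ≤ n * (1 / (4096 * m ^ 4)) := by
          rw [Finset.sum_const, nsmul_eq_mul]
          refine mul_le_mul_of_nonneg_right ?_ (by positivity)
          rw [hn]
          exact_mod_cast Finset.card_le_card (Finset.erase_subset i N)
  have hB0 : 0 ≤ mass w B := mass_nonneg hw
  have h3 : mass w B * (n / 2 * (27 / (32 * (m : ℚ)))) ≤ n * (1 / (4096 * m ^ 4)) := by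
    refine le_trans ?_ hsum
    gcongr
    linarith
  have hn0 : 0 < n := by linarith
  have h4 : mass w B ≤ 1 / (1728 * m ^ 3) := by
    rw [le_div_iff₀ (by positivity)]
    have e1 : mass w B * (n / 2 * (27 / (32 * (m : ℚ)))) =
        n / (4096 * m ^ 4) * (mass w B * (1728 * m ^ 3)) := by
      field_simp; ring
    have e2 : n * (1 / (4096 * (m : ℚ) ^ 4)) = n / (4096 * m ^ 4) * 1 := by ring
    rw [e1, e2] at h3
    exact le_of_mul_le_mul_left h3 (by positivity)
  refine h4.trans (one_div_le_one_div_of_le (by positivity) ?_)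
  have : (m : ℚ) ≤ m ^ 3 := le_self_pow₀ hm' (by norm_num)
  linarith

end IsNearTuran

end Exact

/-! ### From approximate to exact structure -/

section Exact

open scoped Classical

variable {V ι : Type*} {G : SimpleGraph V} {w : V → ℚ} {P : ι → Finset V} {m : ℕ}
  {c : V → Fin m} {N : Finset ι}

/-- The non-adjacent pairs of distinct colours whose two vertices lie in different parts. -/
def IsMissing (G : SimpleGraph V) (P : ι → Finset V) (σ : V → Fin m) (u v : V) : Prop :=
  ¬ G.Adj u v ∧ σ u ≠ σ v ∧ ¬ ∃ i, u ∈ P i ∧ v ∈ P i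

lemma IsDense.eq_of_mem (hP : IsDense G w P m) {i j : ι} {v : V} (hi : v ∈ P i)
    (hj : v ∈ P j) : i = j := by
  by_contra hij
  exact Finset.disjoint_left.1 (hP.disjoint i j hij) hi hj

lemma IsDense.isMissing_of_ne (hP : IsDense G w P m) {σ : V → Fin m} {i j : ι} {u v : V}
    (hu : u ∈ P i) (hv : v ∈ P j) (hij : i ≠ j) (huv : ¬ G.Adj u v) (hσ : σ u ≠ σ v) :
    IsMissing G P σ u v :=
  ⟨huv, hσ, fun ⟨_, hul, hvl⟩ =>
    hij ((hP.eq_of_mem hu hul).trans (hP.eq_of_mem hvl hv))⟩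

namespace IsNearTuran

/-- A vertex has few neighbours of its own colour. -/
lemma mass_same_neighbors_le (hP : IsDense G w P m) {M : Finset ι} (hMN : M ⊆ N)
    (σ : V → Fin m)
    (hκ : ∀ i ∈ M, mass w ((P i).filter fun v => σ v ≠ c v) ≤ 1 / (32 * (m : ℚ))) (u : V)
    (hσ : (N.filter fun h => 1 / (32 * (m : ℚ)) ≤
      mass w ((P h).filter fun x => c x = σ u ∧ x ∈ G.neighborSet u)).card < m) :
    mass w ((M.biUnion P).filter fun v => G.Adj u v ∧ σ u = σ v) ≤
      m + M.card * (1 / (16 * (m : ℚ))) := by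
  have hw := hP.nonneg
  rw [mass_filter_biUnion fun i _ j _ hij => hP.disjoint i j hij]
  set X := N.filter fun h => 1 / (32 * (m : ℚ)) ≤
      mass w ((P h).filter fun x => c x = σ u ∧ x ∈ G.neighborSet u) with hX
  have h1 : ∑ i ∈ M, mass w ((P i).filter fun v => G.Adj u v ∧ σ u = σ v) ≤
      X.card + M.card * (1 / (16 * (m : ℚ))) := by
    refine sum_le_card_add_mul (by positivity)
      (fun i _ => (mass_mono hw (Finset.filter_subset _ _)).trans (hP.mass_part i).le) ?_
    intro i hi hiX
    have hlt : mass w ((P i).filter fun x => c x = σ u ∧ x ∈ G.neighborSet u) <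
        1 / (32 * (m : ℚ)) := by
      by_contra hcon
      exact hiX (Finset.mem_filter.2 ⟨hMN hi, not_lt.1 hcon⟩)
    have h2 : mass w ((P i).filter fun v => G.Adj u v ∧ σ u = σ v) ≤
        mass w ((P i).filter fun x => c x = σ u ∧ x ∈ G.neighborSet u) +
        mass w ((P i).filter fun v => σ v ≠ c v) := by
      refine le_trans (mass_mono hw ?_) (mass_union_le hw)
      intro x hx
      rw [Finset.mem_union, Finset.mem_filter, Finset.mem_filter]
      rw [Finset.mem_filter] at hx
      by_cases hxc : σ x = c x
      · exact Or.inl ⟨hx.1, by rw [← hxc, hx.2.2], hx.2.1⟩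
      · exact Or.inr ⟨hx.1, hxc⟩
    have h3 : (1 : ℚ) / (16 * m) = 1 / (32 * m) + 1 / (32 * m) := by
      rcases eq_or_ne (m : ℚ) 0 with h0 | h0
      · simp [h0]
      · field_simp; norm_num
    linarith [hκ i hi]
  have h2 : (X.card : ℚ) ≤ m := by exact_mod_cast hσ.le
  linarith

/-- The two ends of a monochromatic edge together miss much of one of the other colours in
almost all parts. -/
lemma le_mass_missing_add (hN : IsNearTuran G w P c N) (hP : IsDense G w P m) (hm : 2 ≤ m)
    (hG : G.CliqueFree (m + 1)) {M : Finset ι} (hMN : M ⊆ N) (σ : V → Fin m)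
    (hκ : ∀ i ∈ M, mass w ((P i).filter fun v => σ v ≠ c v) ≤ 1 / (32 * (m : ℚ)))
    {u v : V} (hu : u ∈ M.biUnion P) (hv : v ∈ M.biUnion P) (huv : G.Adj u v)
    (hσuv : σ u = σ v) :
    2 * ((M.card - m - 2) * (3 / (8 * (m : ℚ)))) ≤
      mass w ((M.biUnion P).filter (IsMissing G P σ u)) +
      mass w ((M.biUnion P).filter (IsMissing G P σ v)) := by
  have hw := hP.nonneg
  have hm0 : (2 : ℚ) ≤ m := by exact_mod_cast hm
  obtain ⟨i, hi, hui⟩ := Finset.mem_biUnion.1 hu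
  obtain ⟨j, hj, hvj⟩ := Finset.mem_biUnion.1 hv
  have hTcard : (Finset.univ.erase (σ u)).card = m - 1 := by
    rw [Finset.card_erase_of_mem (Finset.mem_univ _)]; simp
  obtain ⟨Z, hZ⟩ : ∃ Z, Z = G.neighborSet u ∩ G.neighborSet v := ⟨_, rfl⟩
  obtain ⟨t, htT, ht⟩ := hN.exists_missed_colour hw (Finset.univ.erase (σ u))
    (Finset.card_pos.1 (by omega)) (Z := Z)
    (by rw [hTcard, hZ]; exact cliqueFreeOn_common_neighbors hG huv)
  rw [hTcard] at ht
  have htu : t ≠ σ u := Finset.ne_of_mem_erase htT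
  set X := N.filter fun h => 1 / (32 * (m : ℚ)) ≤
    mass w ((P h).filter fun x => c x = t ∧ x ∈ Z) with hX
  have hpart : ∀ h ∈ M, h ∉ insert i (insert j X) → 3 / (4 * (m : ℚ)) ≤
      mass w ((P h).filter (IsMissing G P σ u)) +
        mass w ((P h).filter (IsMissing G P σ v)) := by
    intro h hh hhX
    simp only [Finset.mem_insert, not_or] at hhX
    obtain ⟨hhi, hhj, hhX⟩ := hhX
    have hlt : mass w ((P h).filter fun x => c x = t ∧
        x ∈ Z) < 1 / (32 * (m : ℚ)) := by
      by_contra hcon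
      exact hhX (Finset.mem_filter.2 ⟨hMN hh, not_lt.1 hcon⟩)
    have h2 := hN.le_mass_not_mem (hMN hh) hlt
    have h3 : mass w ((P h).filter fun x => c x = t ∧
        x ∉ Z) ≤
        (mass w ((P h).filter (IsMissing G P σ u)) +
          mass w ((P h).filter (IsMissing G P σ v))) +
        mass w ((P h).filter fun v => σ v ≠ c v) := by
      refine le_trans (mass_mono hw ?_) ((mass_union_le hw).trans
        (add_le_add (mass_union_le hw) le_rfl))
      intro x hx
      rw [Finset.mem_union, Finset.mem_union, Finset.mem_filter, Finset.mem_filter,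
        Finset.mem_filter]
      rw [Finset.mem_filter] at hx
      obtain ⟨hxh, hxt, hxZ⟩ := hx
      by_cases hxc : σ x = c x
      · left
        have hσx : σ u ≠ σ x := by rw [hxc, hxt]; exact htu.symm
        by_cases hxu : G.Adj u x
        · have hxv : ¬ G.Adj v x := fun hxv => hxZ (hZ ▸ ⟨hxu, hxv⟩)
          exact Or.inr ⟨hxh, hP.isMissing_of_ne hvj hxh (Ne.symm hhj) hxv (hσuv ▸ hσx)⟩
        · exact Or.inl ⟨hxh, hP.isMissing_of_ne hui hxh (Ne.symm hhi) hxu hσx⟩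
      · exact Or.inr ⟨hxh, hxc⟩
    have h4 : (27 : ℚ) / (32 * m) = 26 / (32 * m) + 1 / (32 * m) := by ring
    have h5 : (3 : ℚ) / (4 * m) ≤ 26 / (32 * m) := by
      rw [div_le_div_iff₀ (by positivity) (by positivity)]
      linarith
    linarith [hκ h hh]
  have h1 := card_sub_mul_le_sum (by positivity)
    (fun h _ => add_nonneg (mass_nonneg hw) (mass_nonneg hw)) hpart
  rw [Finset.sum_add_distrib, ← mass_filter_biUnion fun i _ j _ hij => hP.disjoint i j hij,
    ← mass_filter_biUnion fun i _ j _ hij => hP.disjoint i j hij] at h1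
  have h6 : ((insert i (insert j X)).card : ℚ) ≤ m + 2 := by
    have := Finset.card_insert_le i (insert j X)
    have := Finset.card_insert_le j X
    have : (insert i (insert j X)).card ≤ m + 2 := by omega
    exact_mod_cast this
  have h7 : 2 * ((M.card - m - 2) * (3 / (8 * (m : ℚ)))) =
      (M.card - (m + 2)) * (3 / (4 * (m : ℚ))) := by
    field_simp; ring
  rw [h7]
  refine le_trans (mul_le_mul_of_nonneg_right ?_ (by positivity)) h1
  linarith

/-- Vertex by vertex, the missing pairs outweigh the monochromatic edges: if `u` and `v` are
adjacent and have the same colour, then some other colour is almost disjoint from their common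
neighbourhood in almost all parts, so one of them misses much of it; and no vertex has many
neighbours of its own colour. Hence there is neither a monochromatic edge nor a missing pair
as soon as there are at least as many monochromatic edges as missing pairs. -/
lemma inside_eq_zero_and_miss_eq_zero (hN : IsNearTuran G w P c N)
    (hP : IsDense G w P m) (hm : 2 ≤ m) (hG : G.CliqueFree (m + 1)) (σ : V → Fin m)
    (hσ : ∀ v, (N.filter fun h => 1 / (32 * (m : ℚ)) ≤
      mass w ((P h).filter fun x => c x = σ v ∧ x ∈ G.neighborSet v)).card < m)
    {M : Finset ι} (hMN : M ⊆ N) (hM : 16 * m ^ 2 ≤ M.card)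
    (hle : pairMass w (IsMissing G P σ) (M.biUnion P) (M.biUnion P) ≤
      pairMass w (fun u v => G.Adj u v ∧ σ u = σ v) (M.biUnion P) (M.biUnion P)) :
    pairMass w (fun u v => G.Adj u v ∧ σ u = σ v) (M.biUnion P) (M.biUnion P) = 0 ∧
    pairMass w (IsMissing G P σ) (M.biUnion P) (M.biUnion P) = 0 := by
  have hw := hP.nonneg
  have hm0 : (2 : ℚ) ≤ m := by exact_mod_cast hm
  set S := M.biUnion P with hS
  set n : ℚ := (M.card : ℚ) with hn
  have hnm : 16 * (m : ℚ) ^ 2 ≤ n := by rw [hn]; exact_mod_cast hM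
  have hNcard : 2 * m ≤ N.card := by
    have := Finset.card_le_card hMN
    nlinarith
  have hκ : ∀ i ∈ M, mass w ((P i).filter fun v => σ v ≠ c v) ≤ 1 / (32 * (m : ℚ)) :=
    fun i hi => hN.mass_recoloured_le hP (by omega) hNcard σ hσ (hMN hi)
  have key := mul_pairMass_le_of_le_add (w := w) hw
    (R := fun u v => G.Adj u v ∧ σ u = σ v) (fun u v h => ⟨h.1.symm, h.2.symm⟩)
    (d := fun u => mass w (S.filter (IsMissing G P σ u))) (fun _ => mass_nonneg hw)
    (fun u hu v hv huv => hN.le_mass_missing_add hP hm hG hMN σ hκ hu hv huv.1 huv.2)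
    (fun u _ => mass_same_neighbors_le hP hMN σ hκ u (hσ u))
  have hsum : ∑ u ∈ S, w u * mass w (S.filter (IsMissing G P σ u)) = pairMass w (IsMissing G P σ) S S :=
    pairMass_eq_sum_mass.symm
  rw [hsum] at key
  set I := pairMass w (fun u v => G.Adj u v ∧ σ u = σ v) S S with hI
  have hI0 : 0 ≤ I := pairMass_nonneg hw
  have hR0 : 0 ≤ pairMass w (IsMissing G P σ) S S := pairMass_nonneg hw
  have hb0 : 0 ≤ (m : ℚ) + n * (1 / (16 * m)) := by positivity
  have hgap : (m : ℚ) + n * (1 / (16 * m)) < (n - m - 2) * (3 / (8 * (m : ℚ))) := by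
    have e : (n - m - 2) * (3 / (8 * (m : ℚ))) - ((m : ℚ) + n * (1 / (16 * m))) =
        (5 * n - 6 * m - 12 - 16 * m ^ 2) / (16 * m) := by
      field_simp; ring
    have : 0 < (5 * n - 6 * m - 12 - 16 * m ^ 2) / (16 * (m : ℚ)) :=
      div_pos (by nlinarith) (by positivity)
    linarith
  -- The weight of the missing pairs at the ends of a monochromatic edge exceeds, on average, the
  -- largest possible weight of the neighbours of the same colour, so `hle` is only possible if `I = 0`.
  have hIle : (n - m - 2) * (3 / (8 * (m : ℚ))) * I ≤ (m + n * (1 / (16 * m))) * I :=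
    key.trans (mul_le_mul_of_nonneg_left hle hb0)
  have hIz : I = 0 := by
    rcases hI0.eq_or_lt with h | h
    · exact h.symm
    · exact absurd (le_of_mul_le_mul_right hIle h) (not_le.2 hgap)
  exact ⟨hIz, le_antisymm (hIz ▸ hle) hR0⟩

end IsNearTuran

/-- The parts in `N` form a complete multipartite graph with respect to the colouring `σ`,
apart from monochromatic edges, and each of them is divided evenly between the colours. -/
structure IsExactTuran (G : SimpleGraph V) (w : V → ℚ) (P : ι → Finset V) (σ : V → Fin m)
    (N : Finset ι) : Prop where
  adj : ∀ i ∈ N, ∀ j ∈ N, i ≠ j → ∀ u ∈ P i, ∀ v ∈ P j, σ u ≠ σ v → G.Adj u v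
  balanced : ∀ i ∈ N, ∀ s, mass w ((P i).filter (σ · = s)) = 1 / m

/-- Recolour every vertex by a colour it hardly sees, and keep only parts whose colour classes
are ordered in the same way by size. By Chebyshev's inequality the monochromatic edges then
weigh at least as much as the missing pairs between these parts, so there are none of either,
and equality in Chebyshev's inequality makes all but one of the parts balanced. -/
lemma IsNearTuran.exists_isExactTuran (hN : IsNearTuran G w P c N) (hP : IsDense G w P m)
    (hm : 2 ≤ m) (hG : G.CliqueFree (m + 1)) {n : ℕ} (hn : 16 * m ^ 2 ≤ n)
    (hcard : m ! * (n + 1) ≤ N.card) :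
    ∃ (σ : V → Fin m) (M : Finset ι), n ≤ M.card ∧ IsExactTuran G w P σ M := by
  have hw := hP.nonneg
  have hσ : ∀ v, ∃ s, (N.filter fun h => 1 / (32 * (m : ℚ)) ≤
      mass w ((P h).filter fun x => c x = s ∧ x ∈ G.neighborSet v)).card < m := by
    intro v
    obtain ⟨s, _, hs⟩ := hN.exists_missed_colour hw Finset.univ
      ⟨⟨0, by omega⟩, Finset.mem_univ _⟩ (Z := G.neighborSet v)
      (by simpa using cliqueFreeOn_neighborSet hG v)
    exact ⟨s, by simpa using hs⟩
  choose σ hσ using hσ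
  set a : ι → Fin m → ℚ := fun i s => mass w ((P i).filter (σ · = s)) with ha
  have ha1 : ∀ i, ∑ s, a i s = 1 := fun i => hP.sum_colour σ i
  choose τ hτ using fun i => exists_antitone_perm (a i)
  obtain ⟨ρ, _, hρ⟩ := Finset.exists_le_card_fiber_of_mul_le_card_of_maps_to (s := N)
    (t := (Finset.univ : Finset (Equiv.Perm (Fin m)))) (f := τ) (n := n + 1) (by simp)
    Finset.univ_nonempty (by
      rw [Finset.card_univ, Fintype.card_perm, Fintype.card_fin]; exact hcard)
  set M := N.filter (τ · = ρ) with hM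
  have hMN : M ⊆ N := Finset.filter_subset _ _
  have hord : ∀ i ∈ M, ∀ j ∈ M, ∀ s t, 0 ≤ (a i s - a i t) * (a j s - a j t) := by
    intro i hi j hj
    have hi' := hτ i
    have hj' := hτ j
    rw [(Finset.mem_filter.1 hi).2] at hi'
    rw [(Finset.mem_filter.1 hj).2] at hj'
    exact mul_sub_nonneg_of_antitone ρ hi' hj'
  have hdisj : (M : Set ι).PairwiseDisjoint P := fun i _ j _ hij => hP.disjoint i j hij
  have hsame : ∀ i j, pairMass w (fun u v => σ u = σ v) (P i) (P j) = ∑ s, a i s * a j s :=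
    fun i j => pairMass_same_eq σ Finset.univ (by simp)
  have hle : pairMass w (IsMissing G P σ) (M.biUnion P) (M.biUnion P) ≤
      pairMass w (fun u v => G.Adj u v ∧ σ u = σ v) (M.biUnion P) (M.biUnion P) := by
    rw [pairMass_biUnion hdisj, pairMass_biUnion hdisj]
    refine Finset.sum_le_sum fun i hi => Finset.sum_le_sum fun j hj => ?_
    by_cases hij : i = j
    · subst hij
      rw [pairMass_eq_zero fun u hu v hv h => h.2.2 ⟨i, hu, hv⟩]
      exact pairMass_nonneg hw
    · have h1 := hP.same_add_miss_le σ hij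
      have h2 := one_div_card_le_sum_mul (hord i hi j hj) (ha1 i) (ha1 j)
      rw [← hsame, Fintype.card_fin] at h2
      have h3 : pairMass w (IsMissing G P σ) (P i) (P j) ≤
          pairMass w (fun u v => ¬ G.Adj u v ∧ σ u ≠ σ v) (P i) (P j) :=
        pairMass_mono hw subset_rfl subset_rfl fun u _ v _ h => ⟨h.1, h.2.1⟩
      linarith
  obtain ⟨hin, hmiss⟩ := hN.inside_eq_zero_and_miss_eq_zero hP hm hG σ hσ hMN
    (by omega) hle
  have hor : ∀ i ∈ M, ∀ j ∈ M, i ≠ j → (∀ s, a i s = 1 / m) ∨ ∀ s, a j s = 1 / m := by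
    intro i hi j hj hij
    have h0 : pairMass w (fun u v => G.Adj u v ∧ σ u = σ v) (P i) (P j) = 0 :=
      pairMass_eq_zero fun u hu v hv =>
        not_rel_of_pairMass_eq_zero hP.pos hin (Finset.mem_biUnion.2 ⟨i, hi, hu⟩)
          (Finset.mem_biUnion.2 ⟨j, hj, hv⟩)
    have h1 := hP.same_add_miss_le σ hij
    have h2 : 0 ≤ pairMass w (fun u v => ¬ G.Adj u v ∧ σ u ≠ σ v) (P i) (P j) :=
      pairMass_nonneg hw
    rw [h0, hsame] at h1
    have := constant_of_sum_mul_le (hord i hi j hj) (ha1 i) (ha1 j)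
      (by rw [Fintype.card_fin]; linarith)
    rwa [Fintype.card_fin] at this
  refine ⟨σ, M.filter fun i => ∀ s, a i s = 1 / m, ?_, ?_, ?_⟩
  · have h1 : (M.filter fun i => ¬ ∀ s, a i s = 1 / m).card ≤ 1 := by
      rw [Finset.card_le_one]
      intro i hi j hj
      by_contra hij
      rw [Finset.mem_filter] at hi hj
      rcases hor i hi.1 j hj.1 hij with h | h
      · exact hi.2 h
      · exact hj.2 h
    have h2 := Finset.card_filter_add_card_filter_not (s := M) (fun i => ∀ s, a i s = 1 / m)
    omega
  · intro i hi j hj hij u hu v hv huv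
    by_contra hadj
    refine not_rel_of_pairMass_eq_zero hP.pos hmiss
      (Finset.mem_biUnion.2 ⟨i, Finset.mem_of_mem_filter i hi, hu⟩)
      (Finset.mem_biUnion.2 ⟨j, Finset.mem_of_mem_filter j hj, hv⟩) ⟨hadj, huv, ?_⟩
    rintro ⟨k, huk, hvk⟩
    have h1 : k = i := by
      by_contra hne
      exact Finset.disjoint_left.1 (hP.disjoint k i hne) huk hu
    have h2 : k = j := by
      by_contra hne
      exact Finset.disjoint_left.1 (hP.disjoint k j hne) hvk hv
    exact hij (h1.symm.trans h2)
  · intro i hi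
    exact (Finset.mem_filter.1 hi).2

end Exact

/-! ### Extension to the whole graph -/

section Extension

open scoped Classical

variable {V ι : Type*} {G : SimpleGraph V} {w : V → ℚ} {P : ι → Finset V} {m : ℕ}
  {σ : V → Fin m} {N : Finset ι}

lemma exists_pos_le_weight [Finite V] (hw : ∀ v, 0 < w v) : ∃ η : ℚ, 0 < η ∧ ∀ v, η ≤ w v := by
  rcases isEmpty_or_nonempty V with h | h
  · exact ⟨1, one_pos, fun v => (IsEmpty.false v).elim⟩
  · obtain ⟨v, hv⟩ := Finite.exists_min w
    exact ⟨w v, hw v, hv⟩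

lemma forall_not_of_mass_filter_eq_zero (hw : ∀ v, 0 < w v) {A : Finset V} {p : V → Prop}
    [DecidablePred p] (h : mass w (A.filter p) = 0) {v : V} (hv : v ∈ A) : ¬ p v := by
  intro hp
  unfold mass at h
  rw [Finset.sum_eq_zero_iff_of_nonneg fun v _ => (hw v).le] at h
  exact (hw v).ne' (h v (Finset.mem_filter.2 ⟨hv, hp⟩))

namespace IsExactTuran

/-- In the exact situation there are no missing pairs, and any positive weight counts as
substantial: a set `Z` without a clique of size `#T` is disjoint from some colour in `T`, in all
but fewer than `#T` of the parts. -/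
lemma exists_missed_colour [Finite V] (hN : IsExactTuran G w P σ N) (hw : ∀ v, 0 < w v)
    (T : Finset (Fin m)) (hT : T.Nonempty) {Z : Set V} (hZ : G.CliqueFreeOn Z T.card) :
    ∃ s ∈ T, ∃ X : Finset ι, X.card < T.card ∧
      ∀ h ∈ N, h ∉ X → ∀ x ∈ P h, σ x = s → x ∉ Z := by
  obtain ⟨η, hη, hηw⟩ := exists_pos_le_weight hw
  have hw0 : ∀ v, 0 ≤ w v := fun v => (hw v).le
  obtain ⟨s, hs, hcard⟩ := exists_colour_few_hits (ε := 0) hw0 σ P N hη (by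
    intro i hi j hj hij
    exact (pairMass_eq_zero fun u hu v hv h =>
      h.1 (hN.adj i hi j hj hij u hu v hv h.2)).le) T hT (by rw [mul_zero]; positivity) hZ
  refine ⟨s, hs, _, hcard, ?_⟩
  intro h hh hX x hx hxs hxZ
  refine hX (Finset.mem_filter.2 ⟨hh, (hηw x).trans ?_⟩)
  have h1 : mass w {x} = w x := by simp [mass]
  rw [← h1]
  exact mass_mono hw0 (by simp [hx, hxs, hxZ])

lemma exists_mem (hN : IsExactTuran G w P σ N) (hm : 0 < m) {h : ι} (hh : h ∈ N)
    (t : Fin m) : ∃ x ∈ P h, σ x = t := by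
  by_contra hcon
  push Not at hcon
  have h1 := hN.balanced h hh t
  rw [Finset.filter_false_of_mem hcon] at h1
  have : (0 : ℚ) < 1 / m := by positivity
  simp only [mass, Finset.sum_empty] at h1
  linarith

/-- Let `s` be a colour that `v` hardly sees. Then the parts in `N` contain more missing pairs
at `v` than edges from `v` to colour `s`, unless there are no such edges at all: a neighbour of
colour `s` forces `v` to miss yet another colour in almost all parts. -/
lemma inside_lt_miss_or_eq_zero [Finite V] (hN : IsExactTuran G w P σ N)
    (hP : IsDense G w P m) (hm : 2 ≤ m) (hG : G.CliqueFree (m + 1)) (hcard : 16 * m ^ 2 ≤ N.card)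
    {v : V} {s : Fin m} {X : Finset ι} (hX : X.card < m)
    (hs : ∀ h ∈ N, h ∉ X → ∀ x ∈ P h, σ x = s → ¬ G.Adj v x) (i : ι) :
    ∑ h ∈ N.erase i, mass w ((P h).filter fun x => G.Adj v x ∧ s = σ x) <
      ∑ h ∈ N.erase i, mass w ((P h).filter fun x => ¬ G.Adj v x ∧ s ≠ σ x) ∨
    ∑ h ∈ N.erase i, mass w ((P h).filter fun x => G.Adj v x ∧ s = σ x) = 0 := by
  have hw := hP.nonneg
  have hm0 : (2 : ℚ) ≤ m := by exact_mod_cast hm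
  by_cases hex : ∃ h₀ ∈ N, ∃ y ∈ P h₀, G.Adj v y ∧ s = σ y
  · left
    obtain ⟨h₀, hh₀, y, hy, hvy, hsy⟩ := hex
    have hTcard : (Finset.univ.erase s).card = m - 1 := by
      rw [Finset.card_erase_of_mem (Finset.mem_univ _)]; simp
    obtain ⟨Z, hZ⟩ : ∃ Z, Z = G.neighborSet v ∩ G.neighborSet y := ⟨_, rfl⟩
    obtain ⟨t, htT, X', hX', ht⟩ := hN.exists_missed_colour hP.pos (Finset.univ.erase s)
      (Finset.card_pos.1 (by omega)) (Z := Z)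
      (by rw [hTcard, hZ]; exact cliqueFreeOn_common_neighbors hG hvy)
    rw [hTcard] at hX'
    have hts : t ≠ s := Finset.ne_of_mem_erase htT
    have h1 : ∑ h ∈ N.erase i, mass w ((P h).filter fun x => G.Adj v x ∧ s = σ x) ≤
        X.card + (N.erase i).card * 0 := by
      refine sum_le_card_add_mul le_rfl
        (fun h _ => (mass_mono hw (Finset.filter_subset _ _)).trans (hP.mass_part h).le) ?_
      intro h hh hhX
      rw [Finset.filter_false_of_mem]
      · simp [mass]
      · rintro x hx ⟨hvx, hsx⟩
        exact hs h (Finset.mem_of_mem_erase hh) hhX x hx hsx.symm hvx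
    have h2 : (((N.erase i).card : ℚ) - (insert h₀ X').card) * (1 / (m : ℚ)) ≤
        ∑ h ∈ N.erase i, mass w ((P h).filter fun x => ¬ G.Adj v x ∧ s ≠ σ x) := by
      refine card_sub_mul_le_sum (by positivity) (fun h _ => mass_nonneg hw) ?_
      intro h hh hhX
      simp only [Finset.mem_insert, not_or] at hhX
      have hhN := Finset.mem_of_mem_erase hh
      rw [← hN.balanced h hhN t]
      refine mass_mono hw fun x hx => ?_
      rw [Finset.mem_filter] at hx ⊢
      refine ⟨hx.1, fun hvx => ht h hhN hhX.2 x hx.1 hx.2 ?_, by rw [hx.2]; exact hts.symm⟩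
      rw [hZ]
      exact ⟨hvx, hN.adj h₀ hh₀ h hhN (Ne.symm hhX.1) y hy x hx.1
        (by rw [← hsy, hx.2]; exact hts.symm)⟩
    have h3 : (X.card : ℚ) ≤ m := by exact_mod_cast hX.le
    have h4 : ((insert h₀ X').card : ℚ) ≤ m := by
      have := Finset.card_insert_le h₀ X'
      exact_mod_cast (by omega : (insert h₀ X').card ≤ m)
    have h5 : 16 * (m : ℚ) ^ 2 - 1 ≤ (N.erase i).card := by
      have := Finset.pred_card_le_card_erase (s := N) (a := i)
      have : 16 * m ^ 2 ≤ (N.erase i).card + 1 := by omega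
      have : 16 * (m : ℚ) ^ 2 ≤ (N.erase i).card + 1 := by exact_mod_cast this
      linarith
    refine lt_of_le_of_lt h1 (lt_of_lt_of_le ?_ h2)
    rw [mul_zero, add_zero, mul_one_div, lt_div_iff₀ (by positivity)]
    nlinarith
  · right
    refine Finset.sum_eq_zero fun h hh => ?_
    rw [Finset.filter_false_of_mem]
    · simp [mass]
    · rintro x hx ⟨hvx, hsx⟩
      exact hex ⟨h, Finset.mem_of_mem_erase hh, x, hx, hvx, hsx⟩

/-- Every vertex of the graph is adjacent to all vertices of the parts in `N`, other than its
own part, whose colour is not one particular colour. -/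
lemma exists_colour_forall_adj [Finite V] (hN : IsExactTuran G w P σ N)
    (hP : IsDense G w P m) (hm : 2 ≤ m) (hG : G.CliqueFree (m + 1)) (hcard : 16 * m ^ 2 ≤ N.card)
    (hcover : ∀ v, ∃ i, v ∈ P i) (v : V) :
    ∃ s, ∀ h ∈ N, v ∉ P h → ∀ x ∈ P h, s ≠ σ x → G.Adj v x := by
  have hw := hP.nonneg
  have hex : ∀ v, ∃ s, ∃ X : Finset ι, X.card < m ∧
      ∀ h ∈ N, h ∉ X → ∀ x ∈ P h, σ x = s → ¬ G.Adj v x := by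
    intro v
    obtain ⟨s, _, X, hX, hs⟩ := hN.exists_missed_colour hP.pos Finset.univ
      ⟨⟨0, by omega⟩, Finset.mem_univ _⟩ (Z := G.neighborSet v)
      (by simpa using cliqueFreeOn_neighborSet hG v)
    exact ⟨s, X, by simpa using hX, hs⟩
  choose s X hX hs using hex
  obtain ⟨i, hvi⟩ := hcover v
  refine ⟨s v, ?_⟩
  set D : V → ℚ := fun u =>
    ∑ h ∈ N.erase i, mass w ((P h).filter fun x => ¬ G.Adj u x ∧ s u ≠ σ x) -
    ∑ h ∈ N.erase i, mass w ((P h).filter fun x => G.Adj u x ∧ s u = σ x) with hD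
  have hD0 : ∀ u, 0 ≤ D u := by
    intro u
    rcases hN.inside_lt_miss_or_eq_zero hP hm hG hcard (hX u) (hs u) i with h | h
    · exact sub_nonneg.2 h.le
    · simp only [hD, h, sub_zero]
      exact Finset.sum_nonneg fun h _ => mass_nonneg hw
  -- Between `P i` and a balanced part the density condition leaves no room for missing pairs.
  have hpart : ∀ h ∈ N.erase i,
      pairMass w (fun u x => ¬ G.Adj u x ∧ s u ≠ σ x) (P i) (P h) ≤
        pairMass w (fun u x => G.Adj u x ∧ s u = σ x) (P i) (P h) := by
    intro h hh
    have hne : i ≠ h := (Finset.ne_of_mem_erase hh).symm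
    let c : V → Fin m := fun x => if x ∈ P i then s x else σ x
    have hci : ∀ x ∈ P i, c x = s x := fun x hx => by simp [c, hx]
    have hch : ∀ x ∈ P h, c x = σ x := fun x hx => by
      simp [c, Finset.disjoint_right.1 (hP.disjoint i h hne) hx]
    have h1 := hP.same_add_miss_le c hne
    have h2 : pairMass w (fun u v => c u = c v) (P i) (P h) = 1 / m := by
      rw [pairMass_same_eq c Finset.univ (by simp)]
      have : ∀ t, mass w ((P h).filter (c · = t)) = 1 / m := by
        intro t
        rw [← hN.balanced h (Finset.mem_of_mem_erase hh) t]
        congr 1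
        exact Finset.filter_congr fun x hx => by rw [hch x hx]
      simp only [this]
      rw [← Finset.sum_mul, hP.sum_colour c i, one_mul]
    rw [h2, pairMass_congr (R := fun u v => ¬ G.Adj u v ∧ c u ≠ c v)
        (R' := fun u x => ¬ G.Adj u x ∧ s u ≠ σ x)
        (fun u hu x hx => by rw [hci u hu, hch x hx]),
      pairMass_congr (R := fun u v => G.Adj u v ∧ c u = c v)
        (R' := fun u x => G.Adj u x ∧ s u = σ x)
        (fun u hu x hx => by rw [hci u hu, hch x hx])] at h1
    linarith
  have hsum : ∑ u ∈ P i, w u * D u ≤ 0 := by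
    have e : ∑ u ∈ P i, w u * D u =
        ∑ h ∈ N.erase i, pairMass w (fun u x => ¬ G.Adj u x ∧ s u ≠ σ x) (P i) (P h) -
        ∑ h ∈ N.erase i, pairMass w (fun u x => G.Adj u x ∧ s u = σ x) (P i) (P h) := by
      simp only [hD, mul_sub, Finset.sum_sub_distrib, Finset.mul_sum, pairMass_eq_sum_mass]
      congr 1 <;> exact Finset.sum_comm
    rw [e]
    exact sub_nonpos.2 (Finset.sum_le_sum hpart)
  have hDv : D v = 0 := by
    have h0 : ∀ u ∈ P i, 0 ≤ w u * D u := fun u _ => mul_nonneg (hw u) (hD0 u)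
    have h1 := (Finset.sum_eq_zero_iff_of_nonneg h0).1
      (le_antisymm hsum (Finset.sum_nonneg h0)) v hvi
    exact (mul_eq_zero.1 h1).resolve_left (hP.pos v).ne'
  have hmiss : ∑ h ∈ N.erase i, mass w ((P h).filter fun x => ¬ G.Adj v x ∧ s v ≠ σ x) = 0 := by
    have h1 := sub_eq_zero.1 hDv
    rcases hN.inside_lt_miss_or_eq_zero hP hm hG hcard (hX v) (hs v) i with h | h
    · exact absurd h1 h.ne'
    · rw [h1, h]
  intro h hh hvh x hx hsx
  have hhi : h ≠ i := fun hhi => hvh (hhi ▸ hvi)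
  have h1 := (Finset.sum_eq_zero_iff_of_nonneg fun h _ => mass_nonneg hw).1 hmiss h
    (Finset.mem_erase.2 ⟨hhi, hh⟩)
  by_contra hadj
  exact forall_not_of_mass_filter_eq_zero hP.pos h1 hx ⟨hadj, hsx⟩

/-- The graph is `m`-colourable: two adjacent vertices of the same colour would form a clique
together with vertices of the other colours in the parts in `N`. -/
lemma exists_proper_coloring [Finite V] (hN : IsExactTuran G w P σ N)
    (hP : IsDense G w P m) (hm : 2 ≤ m) (hG : G.CliqueFree (m + 1)) (hcard : 16 * m ^ 2 ≤ N.card)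
    (hcover : ∀ v, ∃ i, v ∈ P i) : ∃ c : V → Fin m, ∀ u v, G.Adj u v → c u ≠ c v := by
  choose c hc using hN.exists_colour_forall_adj hP hm hG hcard hcover
  refine ⟨c, fun u v huv hcuv => ?_⟩
  obtain ⟨i, hui⟩ := hcover u
  obtain ⟨j, hvj⟩ := hcover v
  have hTcard : (Finset.univ.erase (c u)).card = m - 1 := by
    rw [Finset.card_erase_of_mem (Finset.mem_univ _)]; simp
  obtain ⟨t, htT, X, hX, ht⟩ := hN.exists_missed_colour hP.pos (Finset.univ.erase (c u))
    (Finset.card_pos.1 (by omega)) (Z := G.neighborSet u ∩ G.neighborSet v)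
    (by rw [hTcard]; exact cliqueFreeOn_common_neighbors hG huv)
  have htu : t ≠ c u := Finset.ne_of_mem_erase htT
  obtain ⟨h, hhN, hhX⟩ : ∃ h ∈ N, h ∉ insert i (insert j X) := by
    refine Finset.exists_mem_notMem_of_card_lt_card ?_
    have := Finset.card_insert_le i (insert j X)
    have := Finset.card_insert_le j X
    have : (insert i (insert j X)).card ≤ m := by omega
    nlinarith
  simp only [Finset.mem_insert, not_or] at hhX
  obtain ⟨x, hx, hxt⟩ := hN.exists_mem (by omega) hhN t
  refine ht h hhN hhX.2.2 x hx hxt ⟨?_, ?_⟩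
  · exact hc u h hhN (fun hu => hhX.1 (hP.eq_of_mem hu hui)) x hx (by rw [hxt]; exact htu.symm)
  · exact hc v h hhN (fun hv => hhX.2.1 (hP.eq_of_mem hv hvj)) x hx
      (by rw [hxt, ← hcuv]; exact htu.symm)

end IsExactTuran

/-- A dense multipartite graph without `K_{m+1}` is `m`-colourable, if it has sufficiently
many parts. -/
lemma exists_proper_coloring_of_isDense (m : ℕ) (hm : 2 ≤ m) :
    ∃ L : ℕ, ∀ (V ι : Type*) [Finite V] [Fintype ι] (G : SimpleGraph V) (w : V → ℚ)
      (P : ι → Finset V), L ≤ Fintype.card ι → IsDense G w P m → (∀ v, ∃ i, v ∈ P i) →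
      G.CliqueFree (m + 1) → ∃ c : V → Fin m, ∀ u v, G.Adj u v → c u ≠ c v := by
  have hfact : 1 ≤ m ! := Nat.one_le_iff_ne_zero.2 (Nat.factorial_ne_zero m)
  obtain ⟨L, hL⟩ := exists_isNearTuran m (m ! * (16 * m ^ 2 + 1)) (by omega) (by nlinarith)
  refine ⟨L, fun V ι _ _ G w P hℓ hP hcover hG => ?_⟩
  obtain ⟨c, N, hcard, hN⟩ := hL V ι G w P hℓ hP hG
  obtain ⟨σ, M, hM, hMσ⟩ := hN.exists_isExactTuran hP hm hG le_rfl hcard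
  exact hMσ.exists_proper_coloring hP hm hG hM hcover

end Extension

/-! ### From a proper colouring to the extremal class -/

section Isomorphism

open scoped Classical

variable {V : Type*} {ℓ m : ℕ} {G : SimpleGraph V} {P : Fin ℓ → Finset V}

/-- A vertex set that is divided by a map to parts and a colouring is in bijection with the
corresponding set of triples. -/
lemma exists_equiv_blowupVertex [Fintype V] (q : V → Fin ℓ) (c : V → Fin m) (n : Fin ℓ → Fin m → ℕ)
    (hn : ∀ i s, Fintype.card {v // q v = i ∧ c v = s} = n i s) :
    ∃ Φ : V ≃ BlowupVertex n, ∀ v, (Φ v).1 = q v ∧ (Φ v).2.1 = c v := by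
  let e : ∀ i s, {v // q v = i ∧ c v = s} ≃ Fin (n i s) := fun i s =>
    Fintype.equivFinOfCardEq (hn i s)
  let f : V → BlowupVertex n := fun v => ⟨q v, c v, e _ _ ⟨v, rfl, rfl⟩⟩
  have hinj : f.Injective := Function.LeftInverse.injective
    (g := fun x => ((e x.1 x.2.1).symm x.2.2).1) fun v => by simp [f]
  have hsurj : f.Surjective := by
    rintro ⟨i, s, t⟩
    obtain ⟨⟨v, rfl, rfl⟩, rfl⟩ := (e i s).surjective t
    exact ⟨v, rfl⟩
  exact ⟨Equiv.ofBijective f ⟨hinj, hsurj⟩, fun v => ⟨rfl, rfl⟩⟩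

/-- The weights that give each part total weight one, uniformly distributed. -/
lemma exists_weight [DecidableRel G.Adj] (hP : IsPartite G P)
    (hd : ∀ i j : Fin ℓ, i ≠ j → 1 - 1 / (m : ℚ) ≤ G.edgeDensity (P i) (P j)) :
    ∃ w : V → ℚ, IsDense G w P m ∧ ∀ i, ∀ v ∈ P i, w v = 1 / (P i).card := by
  choose p hp using hP.cover
  have hpu : ∀ i, ∀ v ∈ P i, p v = i := by
    intro i v hv
    by_contra hne
    exact Finset.disjoint_left.1 (hP.disjoint _ _ hne) (hp v) hv
  have hpos : ∀ i, (0 : ℚ) < (P i).card := fun i => by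
    exact_mod_cast (hP.nonempty i).card_pos
  have hw : ∀ i, ∀ v ∈ P i, (1 : ℚ) / (P (p v)).card = 1 / (P i).card :=
    fun i v hv => by rw [hpu i v hv]
  refine ⟨fun v => 1 / (P (p v)).card, ⟨fun v => one_div_pos.2 (hpos _), fun i => ?_,
    hP.disjoint, hP.independent, fun i j hij => (hd i j hij).trans_eq ?_⟩, hw⟩
  · unfold mass
    rw [Finset.sum_congr rfl (hw i), Finset.sum_const, nsmul_eq_mul]
    exact mul_one_div_cancel (hpos i).ne'
  · have h1 : pairMass (fun v => (1 : ℚ) / (P (p v)).card) G.Adj (P i) (P j) =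
        ∑ u ∈ P i, ∑ v ∈ P j,
          if G.Adj u v then 1 / ((P i).card : ℚ) * (1 / (P j).card) else 0 := by
      refine Finset.sum_congr rfl fun u hu => Finset.sum_congr rfl fun v hv => ?_
      beta_reduce
      rw [hw i u hu, hw j v hv]
      by_cases h : G.Adj u v <;> simp [h]
    rw [h1, ← Finset.sum_product', ← Finset.sum_filter, Finset.sum_const, nsmul_eq_mul,
      SimpleGraph.edgeDensity_def]
    have h2 : (P i ×ˢ P j).filter (fun x => G.Adj x.1 x.2) = G.interedges (P i) (P j) := by
      ext x
      simp [SimpleGraph.mem_interedges_iff, and_assoc]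
    rw [h2, one_div_mul_one_div, mul_one_div]

/-- A dense multipartite graph with a proper `m`-colouring is extremal. By Chebyshev's
inequality, the colour classes of two unbalanced parts cannot be ordered in the same way by
size, so the unbalanced parts can be placed at the positions of distinct permutations; and no
edge is missing at a balanced part. -/
lemma exists_isExtremal [Fintype V] [DecidableRel G.Adj] (hP : IsPartite G P)
    (hd : ∀ i j : Fin ℓ, i ≠ j → 1 - 1 / (m : ℚ) ≤ G.edgeDensity (P i) (P j))
    (hℓ : m ! ≤ ℓ) (π : Fin (m !) ≃ Equiv.Perm (Fin m)) (c : V → Fin m)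
    (hc : ∀ u v, G.Adj u v → c u ≠ c v) :
    ∃ (n : Fin ℓ → Fin m → ℕ) (H : SimpleGraph (BlowupVertex n)),
      IsExtremal π n H ∧ Nonempty (G ≃g H) := by
  obtain ⟨w, hD, hw⟩ := exists_weight hP hd
  choose p hp using hP.cover
  have hpu : ∀ {i v}, v ∈ P i → p v = i := fun hv => hD.eq_of_mem (hp _) hv
  have hcard : ∀ i, (0 : ℚ) < (P i).card := fun i => by
    exact_mod_cast (hP.nonempty i).card_pos
  set a : Fin ℓ → Fin m → ℚ := fun i s => mass w ((P i).filter (c · = s)) with ha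
  have ha1 : ∀ i, ∑ s, a i s = 1 := fun i => hD.sum_colour c i
  have haN : ∀ i s, a i s = ((P i).filter (c · = s)).card / (P i).card := by
    intro i s
    have : a i s = ∑ v ∈ (P i).filter (c · = s), 1 / ((P i).card : ℚ) :=
      Finset.sum_congr rfl fun v hv => hw i v (Finset.mem_of_mem_filter v hv)
    rw [this, Finset.sum_const, nsmul_eq_mul, mul_one_div]
  have hale : ∀ i s t, a i s ≤ a i t →
      ((P i).filter (c · = s)).card ≤ ((P i).filter (c · = t)).card := by
    intro i s t h
    rw [haN, haN, div_le_div_iff_of_pos_right (hcard i)] at h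
    exact_mod_cast h
  have hpair : ∀ i j, i ≠ j → ∑ s, a i s * a j s +
      pairMass w (fun u v => ¬ G.Adj u v ∧ c u ≠ c v) (P i) (P j) ≤ 1 / m := by
    intro i j hij
    have h1 := hD.same_add_miss_le c hij
    rw [pairMass_same_eq c Finset.univ (by simp),
      pairMass_eq_zero (R := fun u v => G.Adj u v ∧ c u = c v)
        fun u _ v _ h => hc u v h.1 h.2, add_zero] at h1
    exact h1
  have hmiss0 : ∀ i j, 0 ≤ pairMass w (fun u v => ¬ G.Adj u v ∧ c u ≠ c v) (P i) (P j) :=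
    fun i j => pairMass_nonneg hD.nonneg
  choose τ hτ using fun i => exists_antitone_perm (a i)
  set U : Finset (Fin ℓ) := Finset.univ.filter fun i => ¬ ∀ s, a i s = 1 / m with hU
  have hτinj : Set.InjOn τ U := by
    intro i hi j hj hij
    by_contra hne
    have h1 := constant_of_sum_mul_le
      (mul_sub_nonneg_of_antitone (τ i) (hτ i) (hij ▸ hτ j)) (ha1 i) (ha1 j)
      (by rw [Fintype.card_fin]; linarith [hpair i j hne, hmiss0 i j])
    rw [Fintype.card_fin] at h1
    rcases h1 with h | h
    · exact (Finset.mem_filter.1 hi).2 h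
    · exact (Finset.mem_filter.1 hj).2 h
  obtain ⟨g, hg⟩ := Finset.exists_equiv_extend_of_card_eq (α := Fin ℓ)
    (t := (Finset.univ : Finset (Fin ℓ))) (by simp) (s := U)
    (f := fun i => Fin.castLE hℓ (π.symm (τ i))) (Finset.subset_univ _) (by
      intro i hi j hj hij
      exact hτinj hi hj (π.symm.injective (Fin.castLE_injective hℓ hij)))
  let e : Fin ℓ ≃ Fin ℓ := g.trans (Equiv.subtypeUnivEquiv fun _ => Finset.mem_univ _)
  have he : ∀ i ∈ U, e i = Fin.castLE hℓ (π.symm (τ i)) := fun i hi => hg i hi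
  have hbal : ∀ i' : Fin ℓ, m ! ≤ (i' : ℕ) → ∀ s, a (e.symm i') s = 1 / m := by
    intro i' hi'
    by_contra hcon
    have h1 := he (e.symm i') (Finset.mem_filter.2 ⟨Finset.mem_univ _, hcon⟩)
    rw [Equiv.apply_symm_apply] at h1
    have h2 := (π.symm (τ (e.symm i'))).isLt
    rw [h1, Fin.val_castLE] at hi'
    omega
  let n : Fin ℓ → Fin m → ℕ := fun i s => ((P (e.symm i)).filter (c · = s)).card
  obtain ⟨Φ, hΦ⟩ := exists_equiv_blowupVertex (fun v => e (p v)) c n (by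
    intro i s
    rw [Fintype.card_subtype]
    refine congrArg Finset.card ?_
    ext v
    simp only [Finset.mem_filter, Finset.mem_univ, true_and]
    refine and_congr_left fun _ => ⟨fun h => ?_, fun h => ?_⟩
    · rw [← h, Equiv.symm_apply_apply]
      exact hp v
    · rw [hpu h, Equiv.apply_symm_apply])
  have hΦ1 : ∀ x, x.1 = e (p (Φ.symm x)) := fun x => by
    rw [← (hΦ (Φ.symm x)).1, Equiv.apply_symm_apply]
  have hΦ2 : ∀ x, x.2.1 = c (Φ.symm x) := fun x => by
    rw [← (hΦ (Φ.symm x)).2, Equiv.apply_symm_apply]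
  have hmem : ∀ x, Φ.symm x ∈ P (e.symm x.1) := fun x => by
    rw [hΦ1 x, Equiv.symm_apply_apply]
    exact hp _
  -- A pair of distinct colours can only be missing if neither of its parts is balanced.
  have hdel : ∀ u v, p u ≠ p v → c u ≠ c v → ¬ G.Adj u v → ¬ ∀ s, a (p u) s = 1 / m := by
    intro u v huv hcuv hadj hb
    have h1 := hpair _ _ huv
    simp only [hb, ← Finset.mul_sum, ha1, mul_one] at h1
    exact not_rel_of_pairMass_eq_zero hD.pos (le_antisymm (by linarith) (hmiss0 _ _))
      (hp u) (hp v) ⟨hadj, hcuv⟩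
  refine ⟨n, G.comap Φ.symm, ⟨⟨hℓ, ?_, ?_, ?_⟩, ?_, ?_⟩,
    ⟨(SimpleGraph.Iso.comap Φ.symm G).symm⟩⟩
  · intro i hi r r' hr
    refine hale _ _ _ ?_
    by_cases hiU : e.symm i ∈ U
    · have h1 := he _ hiU
      rw [Equiv.apply_symm_apply] at h1
      have h2 : π ⟨i, hi⟩ = τ (e.symm i) := by
        rw [← Equiv.eq_symm_apply]
        have h3 := congrArg Fin.val h1
        exact Fin.ext h3
      rw [h2]
      exact hτ (e.symm i) hr
    · have h1 : ∀ s, a (e.symm i) s = 1 / m := by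
        by_contra hcon
        exact hiU (Finset.mem_filter.2 ⟨Finset.mem_univ _, hcon⟩)
      rw [h1, h1]
  · intro i hi s s'
    have h1 := hbal i hi
    exact le_antisymm (hale _ _ _ (by rw [h1, h1])) (hale _ _ _ (by rw [h1, h1]))
  · intro i
    have h1 : ∑ s, n i s = (P (e.symm i)).card :=
      (Finset.card_eq_sum_card_fiberwise (f := c) (t := Finset.univ) (by simp)).symm
    rw [h1]
    exact (hP.nonempty _).card_pos
  · intro x y hxy
    rw [SimpleGraph.comap_adj] at hxy
    refine ⟨fun h => ?_, fun h => hc _ _ hxy ?_⟩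
    · exact hP.independent _ _ (hmem x) _ (h ▸ hmem y) hxy
    · rw [← hΦ2, ← hΦ2, h]
  · rintro x y ⟨h1, h2⟩ hxy
    rw [SimpleGraph.comap_adj] at hxy
    have hp' : p (Φ.symm x) ≠ p (Φ.symm y) := fun h => h1 (by rw [hΦ1 x, hΦ1 y, h])
    have hc' : c (Φ.symm x) ≠ c (Φ.symm y) := by rwa [← hΦ2, ← hΦ2]
    have hpe : ∀ z : BlowupVertex n, e.symm z.1 = p (Φ.symm z) := fun z => by
      rw [hΦ1 z, Equiv.symm_apply_apply]
    constructor
    · by_contra hlt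
      refine hdel _ _ hp' hc' hxy ?_
      rw [← hpe]
      exact hbal _ (not_lt.1 hlt)
    · by_contra hlt
      refine hdel _ _ hp'.symm hc'.symm (fun h => hxy h.symm) ?_
      rw [← hpe]
      exact hbal _ (not_lt.1 hlt)

end Isomorphism

end PartiteTuran

theorem theorem2 (k : ℕ) (hk : 3 ≤ k) :
    ∃ L : ℕ, ∀ ℓ : ℕ, L ≤ ℓ →
      ∀ (π : Fin ((k - 1)!) ≃ Equiv.Perm (Fin (k - 1)))
        (V : Type*) [Fintype V] (G : SimpleGraph V) [DecidableRel G.Adj]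
        (P : Fin ℓ → Finset V),
        PartiteTuran.IsPartite G P →
        (∀ i j : Fin ℓ, i ≠ j → ((k : ℚ) - 2) / ((k : ℚ) - 1) ≤ G.edgeDensity (P i) (P j)) →
        ¬ G.CliqueFree k ∨
          ∃ (n : Fin ℓ → Fin (k - 1) → ℕ)
            (H : SimpleGraph (PartiteTuran.BlowupVertex n)),
            PartiteTuran.IsExtremal π n H ∧ Nonempty (G ≃g H) := by
  obtain ⟨L, hL⟩ := PartiteTuran.exists_proper_coloring_of_isDense (k - 1) (by omega)
  refine ⟨max L (k - 1)!, ?_⟩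
  intro ℓ hℓ π V _ G _ P hP hd
  by_cases hG : G.CliqueFree k
  · right
    have hm : ((k - 1 : ℕ) : ℚ) = k - 1 := by
      rw [Nat.cast_sub (by omega)]; norm_num
    have hk' : (3 : ℚ) ≤ k := by exact_mod_cast hk
    have hd' : ∀ i j : Fin ℓ, i ≠ j →
        1 - 1 / ((k - 1 : ℕ) : ℚ) ≤ G.edgeDensity (P i) (P j) := by
      intro i j hij
      refine le_of_eq_of_le ?_ (hd i j hij)
      have : (k : ℚ) - 1 ≠ 0 := by linarith
      rw [hm]
      field_simp
      ring
    obtain ⟨w, hw, -⟩ := PartiteTuran.exists_weight hP hd'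
    obtain ⟨c, hc⟩ := hL V (Fin ℓ) G w P (by simpa using le_of_max_le_left hℓ) hw hP.cover
      (by rwa [Nat.sub_add_cancel (by omega)])
    exact PartiteTuran.exists_isExtremal hP hd' (le_of_max_le_right hℓ) π c hc
  · exact Or.inl hG
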